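/- **Conventions.** For $t\ge 1$, the co-matching pattern $\overline M_t$ has vertices $x_1,\dots,x_t,y_1,\dots,y_t$, with sides $X=\{x_1,\dots,x_t\}$ and $Y=\{y_1,\dots,y_t\}$; the pair $x_iy_j$ is *black* if $i\ne j$ and *red* if $i=j$, and pairs inside $X$ or inside $Y$ are *white*. An appearance of $\overline M_t$ in a graph $G$ is an injection $\phi$ of its vertices into $V(G)$ such that $\phi(u)\phi(v)\in E(G)$ for every black pair $uv$ and $\phi(u)\phi(v)\notin E(G)$ for every red pair $uv$. The number of co-matching patterns $\overline M_t$ in $G$ is the number of appearances up to colour-preserving permutations of the vertices of $\overline M_t$. A graph is $d$-degenerate if its vertices have a linear order in which every vertex has at most $d$ neighbours to its left. The machine is a word RAM with $w$-bit words: finitely many registers and a memory of words (initially zero apart from the input), a fixed finite program, and unit cost for assigning a constant, addition, truncated subtraction, multiplication and integer division (all modulo $2^w$), indirect load and store, and conditional jump. The input is $t$ together with an adjacency list representation of $G$ (the numbers $t$ and $n$, an array of $n+1$ offsets, and the concatenated neighbour lists, each in arbitrary order). The word length is only assumed to be at least a constant times $d+t\log (n+2)$. **Statement.** There are a program and constants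 $c, C$ such that for all $n,d\ge 0$, all $t\ge 1$, every $d$-degenerate graph $G$ on $n$ vertices, every adjacency list representation of $G$, and every word length $w\ge c\,(d+t\lfloor\log_2(n+2)\rfloor)$, the program halts on input $(t,G)$ after at most $$C\cdot\big(t^2\,(2t)! + d\,2^d\,n + n^2\,(8d)^t\,d\,t^3\big)$$ steps and outputs the number of co-matching patterns $\overline M_t$ in $G$. (The number $d$ is not part of the input.) Moreover $\operatorname{lc}(\overline M_t)=2$ for all $t\ge 2$, and $\operatorname{hoa}(\overline M_t)=1$ for all $t\ge 1$. Here, for a linear order of the vertices of the pattern, $N^-(u)$ is the set of vertices before $u$ that are joined to $u$ by a black edge; a left-cover is a vertex set $C$ with $X\subseteq C\cup\bigcup_{c\in C}N^-(c)$ or $Y\subseteq C\cup\bigcup_{c\in C}N^-(c)$; and $\operatorname{lc}$ is the maximum over all linear orders of the minimum size of a left-cover. For $Z\in\{X,Y\}$, the signature of an ordering of $Z$ is the multiset, over the vertices $u\notin Z$, of the sets of positions of the black neighbours of $u$ in that ordering; $\operatorname{hoa}$ is the maximum over $Z\in\{X,Y\}$ of the number of classes of orderings of $Z$, where two orderings are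 equivalent if they have the same signature. -/

import Mathlib

/-! ### Degenerate graphs -/

/-- `G` is `d`-degenerate: some linear order of the vertices gives every vertex at most `d`
neighbours to its left. -/
def SimpleGraph.IsDegenerate {V : Type*} (G : SimpleGraph V) (d : ℕ) : Prop :=
  ∃ o : LinearOrder V, ∀ v : V, {u : V | G.Adj v u ∧ o.lt u v}.encard ≤ d

/-! ### Patterns and their appearances in graphs -/

/-- A pattern: a complete graph whose edges are partitioned into black, red and white ones.
The white edges are the edges that are neither black nor red. -/
structure Pattern (V : Type*) where
  black : SimpleGraph V
  red : SimpleGraph V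
  disjoint : Disjoint black red

namespace Pattern

variable {V W : Type*}

/-- An appearance of `H` in `G`: an injection of `V(H)` into `V(G)` (that is, a bijection onto a
set `S ⊆ V(G)`) that maps black edges to edges and red edges to non-edges. -/
def Appearance (H : Pattern V) (G : SimpleGraph W) : Type _ :=
  {φ : V ↪ W // (∀ u v, H.black.Adj u v → G.Adj (φ u) (φ v)) ∧
    (∀ u v, H.red.Adj u v → ¬ G.Adj (φ u) (φ v))}

/-- A permutation of the vertices that preserves the colour of every edge. -/
def IsAutomorphism (H : Pattern V) (α : Equiv.Perm V) : Prop :=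
  (∀ u v, H.black.Adj (α u) (α v) ↔ H.black.Adj u v) ∧
    (∀ u v, H.red.Adj (α u) (α v) ↔ H.red.Adj u v)

/-- Two appearances are the same copy of `H` if they differ by an automorphism of `H`. -/
def sameCopy (H : Pattern V) (G : SimpleGraph W) : Setoid (H.Appearance G) where
  r φ ψ := ∃ α : Equiv.Perm V, H.IsAutomorphism α ∧ ∀ v, ψ.1 v = φ.1 (α v)
  iseqv :=
    { refl := fun _ => ⟨1, ⟨fun _ _ => Iff.rfl, fun _ _ => Iff.rfl⟩, fun _ => rfl⟩
      symm := by
        rintro φ ψ ⟨α, ⟨hb, hr⟩, h⟩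
        refine ⟨α.symm, ⟨fun u v => ?_, fun u v => ?_⟩, fun v => ?_⟩
        · have := hb (α.symm u) (α.symm v)
          simpa using this.symm
        · have := hr (α.symm u) (α.symm v)
          simpa using this.symm
        · have := h (α.symm v)
          simpa using this.symm
      trans := by
        rintro φ ψ χ ⟨α, ⟨hb, hr⟩, h⟩ ⟨β, ⟨hb', hr'⟩, h'⟩
        refine ⟨β.trans α, ⟨fun u v => ?_, fun u v => ?_⟩, fun v => ?_⟩
        · simpa using (hb (β u) (β v)).trans (hb' u v)
        · simpa using (hr (β u) (β v)).trans (hr' u v)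
        · simpa using (h' v).trans (h (β v)) }

/-- The number of times that `H` appears in `G`, i.e. the number of copies of `H` in `G`. -/
noncomputable def count (H : Pattern V) (G : SimpleGraph W) : ℕ :=
  Nat.card (Quotient (H.sameCopy G))

/-! ### Left-covers -/

/-- The left neighbourhood (in the black edges) of `u` under the order `o`. -/
def leftNeighbors (H : Pattern V) (o : LinearOrder V) (u : V) : Set V :=
  {v : V | H.black.Adj u v ∧ o.lt v u}

/-- `C` together with its left neighbourhood contains one of the two sides `X`, `Y`. -/
def IsLeftCover (H : Pattern V) (o : LinearOrder V) (X Y C : Finset V) : Prop :=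
  (X : Set V) ⊆ (⋃ c ∈ C, H.leftNeighbors o c) ∪ C ∨
    (Y : Set V) ⊆ (⋃ c ∈ C, H.leftNeighbors o c) ∪ C

/-- The minimum size of a left-cover of the ordered pattern `(H, o)` with bipartition `(X, Y)`. -/
noncomputable def orderedLeftCoveringNumber (H : Pattern V) (X Y : Finset V)
    (o : LinearOrder V) : ℕ :=
  sInf {k : ℕ | ∃ C : Finset V, H.IsLeftCover o X Y C ∧ C.card = k}

/-- The left-covering number of a (finite) pattern with bipartition `(X, Y)`: the maximum over all
orders of the vertices. -/
noncomputable def leftCoveringNumber (H : Pattern V) (X Y : Finset V) : ℕ :=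
  ⨆ o : LinearOrder V, H.orderedLeftCoveringNumber X Y o

/-! ### Half-ordering asymmetry -/

variable [Fintype V] [DecidableEq V]

/-- The signature of an ordering `e` of the side `Z`: the multiset, over the vertices `u` outside
of `Z`, of the sets of positions of the (black) neighbours of `u`. -/
def signature (H : Pattern V) (Z : Finset V) (e : Fin Z.card ≃ Z) :
    Multiset (Set (Fin Z.card)) :=
  (Zᶜ).val.map fun u => {i | H.black.Adj u (e i)}

/-- The number of classes of orderings of `Z`, two orderings being equivalent if they have the
same signature. -/
noncomputable def halfOrderingAsymmetrySide (H : Pattern V) (Z : Finset V) : ℕ :=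
  Nat.card (Quotient (Setoid.ker (H.signature Z)))

/-- The half-ordering asymmetry of a pattern with bipartition `(X, Y)`. -/
noncomputable def halfOrderingAsymmetry (H : Pattern V) (X Y : Finset V) : ℕ :=
  max (H.halfOrderingAsymmetrySide X) (H.halfOrderingAsymmetrySide Y)

end Pattern

/-! ### Co-matchings -/

/-- The co-matching on vertices `x_i = inl i` and `y_i = inr i`: the edge `x_i y_j` is black for
`i ≠ j` and red for `i = j`; edges inside a side are white. -/
def coMatching (t : ℕ) : Pattern (Fin t ⊕ Fin t) where
  black := SimpleGraph.fromRel fun p q => ∃ i j, i ≠ j ∧ p = Sum.inl i ∧ q = Sum.inr j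
  red := SimpleGraph.fromRel fun p q => ∃ i, p = Sum.inl i ∧ q = Sum.inr i
  disjoint := by
    rw [SimpleGraph.disjoint_left]
    rintro (p | p) (q | q) h h' <;> simp_all

/-- The side `x_1, …, x_t` of the co-matching. -/
def coMatchingX (t : ℕ) : Finset (Fin t ⊕ Fin t) := Finset.univ.map Function.Embedding.inl

/-- The side `y_1, …, y_t` of the co-matching. -/
def coMatchingY (t : ℕ) : Finset (Fin t ⊕ Fin t) := Finset.univ.map Function.Embedding.inr

/-! ### A word RAM -/

namespace WordRAM

/-- Arithmetic operations of the machine. -/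
inductive BinOp
  | add | sub | mul | div

/-- `sub` is cut off at `0`, `div` is integer division. -/
def BinOp.eval : BinOp → ℕ → ℕ → ℕ
  | .add, x, y => x + y
  | .sub, x, y => x - y
  | .mul, x, y => x * y
  | .div, x, y => x / y

/-- Instructions. Natural numbers `i j k` name registers, `l` is a position in the program. -/
inductive Instr
  /-- `reg i := a` -/
  | const (i a : ℕ)
  /-- `reg i := reg j op reg k` -/
  | arith (op : BinOp) (i j k : ℕ)
  /-- `reg i := mem (reg j)` -/
  | load (i j : ℕ)
  /-- `mem (reg i) := reg j` -/
  | store (i j : ℕ)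
  /-- jump to `l` if `reg i = 0` -/
  | jumpZero (i l : ℕ)

/-- A program is a finite list of instructions, so it uses finitely many registers. -/
abbrev Program := List Instr

/-- A configuration: program counter, registers, memory. -/
structure Config where
  pc : ℕ
  reg : ℕ → ℕ
  mem : ℕ → ℕ

/-- Execution of one instruction with words of `w` bits: everything that is written into a
register is reduced modulo `2 ^ w`, hence all contents and all addresses are smaller
than `2 ^ w`. -/
def exec (w : ℕ) (s : Config) : Instr → Config
  | .const i a => ⟨s.pc + 1, Function.update s.reg i (a % 2 ^ w), s.mem⟩
  | .arith op i j k =>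
      ⟨s.pc + 1, Function.update s.reg i (op.eval (s.reg j) (s.reg k) % 2 ^ w), s.mem⟩
  | .load i j => ⟨s.pc + 1, Function.update s.reg i (s.mem (s.reg j) % 2 ^ w), s.mem⟩
  | .store i j => ⟨s.pc + 1, s.reg, Function.update s.mem (s.reg i) (s.reg j)⟩
  | .jumpZero i l => ⟨if s.reg i = 0 then l else s.pc + 1, s.reg, s.mem⟩

/-- One step; the machine has halted when the program counter is outside of the program. -/
def step (P : Program) (w : ℕ) (s : Config) : Config :=
  match P[s.pc]? with
  | some I => exec w s I
  | none => s

/-- The initial configuration: the input stands at the beginning of the memory, everything else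
is zero. -/
def init (w : ℕ) (x : List ℕ) : Config := ⟨0, fun _ => 0, fun a => x.getD a 0 % 2 ^ w⟩

/-- On input `x`, with words of `w` bits, the program `P` halts after at most `T` steps, and
then register `0` contains `y`. -/
def ComputesWithin (P : Program) (w : ℕ) (x : List ℕ) (T y : ℕ) : Prop :=
  ∃ k ≤ T, P.length ≤ ((step P w)^[k] (init w x)).pc ∧ ((step P w)^[k] (init w x)).reg 0 = y

end WordRAM

/-! ### Graphs as inputs -/

/-- `L` is an adjacency list representation of `G`: `L v` lists the neighbours of `v`, in an
arbitrary order. -/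
def IsAdjacencyList {n : ℕ} (G : SimpleGraph (Fin n)) (L : Fin n → List (Fin n)) : Prop :=
  ∀ v, (L v).Nodup ∧ ∀ u, u ∈ L v ↔ G.Adj v u

/-- The input for the parameter `t` and a graph with adjacency lists `L`: the numbers `t` and `n`,
then the `n + 1` offsets (the `i`-th one is the total length of the first `i` lists), then the
concatenation of the lists. -/
def encodeInput {n : ℕ} (t : ℕ) (L : Fin n → List (Fin n)) : List ℕ :=
  t :: n :: ((List.range (n + 1)).map fun i => (((List.ofFn L).take i).map List.length).sum) ++
    (List.ofFn L).flatten.map Fin.val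

/-!
A co-matching is counted at the vertex `v` of it that comes first in an order in which vertices of
minimum degree are removed one by one. If `A` is the set of vertices present when `v` is removed
and `G` is `d`-degenerate, then `v` has at most `d` neighbours in `A`
(`SimpleGraph.IsDegenerate.exists_card_filter_le`). With the `m = t - 1` vertices `y` of the
opposite side that are joined to `v` there are thus at most `d ^ m` choices, and the vertex `p` of
the opposite side that is not joined to `v` is any of the at most `n` other vertices. The vertices
`v` and `p` form a left-cover of size `2`, if the order of removal is read backwards: `v` and `y`
determine one side up to `p`. Once the side `p, y` is fixed, the vertices of the side of `v` can be
chosen independently of each other, as any two vertices of a side are joined by a white edge. The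
number of co-matchings at `v` is therefore a sum over `y` and `p` of products over `j` of numbers
of vertices `x` in the adjacency list of `p` (`card_filter_coMatchingPairs`). Since the sum of the
lengths of all lists is at most `2 * d * n` (`SimpleGraph.IsDegenerate.sum_card_le`), each round
takes time `O(n * d ^ t * t ^ 3)`, and all `n` rounds together take time
`O(n ^ 2 * d ^ t * t ^ 3)`.

The sum over all `v` counts pairs of enumerated sides. Such pairs are the appearances of the
co-matching, and the automorphism group has order `2 * t !` (`card_coMatchingPairs_univ`); by
symmetry, the removed vertex stands in each of the `2 * t` places equally often
(`card_coMatchingPairs_erase`). Hence the sum of the numbers of pairs in which it is the first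
vertex of the first side is `(t - 1)!` times the number of copies. All sums and products are
computed modulo `2 ^ w`, and the final sum is at most `n ^ (2 * t)`, which is smaller than `2 ^ w`
for words of the assumed length (`WordRAM.fits_of_le`).

For the machine, the algorithm is written in a small language of expressions, with sums and
products over ranges, and of commands with bounded loops. `WordRAM.Expr.reach` and
`WordRAM.Cmd.reach` show that a compiler into the instructions of the machine is correct and takes
exactly the number of steps predicted by `WordRAM.Expr.cost` and `WordRAM.Cmd.time`; loops are
treated by the rule `WordRAM.Cmd.loop_spec`. The degeneracy `d` is not known to the program, which
just removes vertices of minimum degree.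

The left-covering number is `2` because the last vertex of any order is joined to all of the
opposite side but its partner, whereas a single vertex never covers a side. The half-ordering
asymmetry is `1` because the signature of every ordering of a side consists of the complements of
the singletons.
-/

namespace WordRAM

/-! ### A structured language and its compiler -/

/-- Expressions over named variables and a read-only memory. `fold o a i b e` combines the values
of `e`, for `i` from `0` up to (but excluding) the value of `b`, by the operation `o`, starting
from the number `a`. -/
inductive Expr
  | var (i : ℕ)
  | lit (a : ℕ)
  | op (o : BinOp) (e f : Expr)
  | load (e : Expr)
  | fold (o : BinOp) (a i : ℕ) (b e : Expr)

namespace Expr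

/-- The value of an expression on a machine with `w`-bit words, where `m` is the memory and `ρ`
gives the values of the variables. -/
def eval (w : ℕ) (m : ℕ → ℕ) : Expr → (ℕ → ℕ) → ℕ
  | var i, ρ => ρ i
  | lit a, _ => a % 2 ^ w
  | op o e f, ρ => o.eval (e.eval w m ρ) (f.eval w m ρ) % 2 ^ w
  | load e, ρ => m (e.eval w m ρ) % 2 ^ w
  | fold o a i b e, ρ => Nat.rec (a % 2 ^ w)
      (fun k r => o.eval r (e.eval w m (Function.update ρ i k)) % 2 ^ w) (b.eval w m ρ)

/-- The number of steps that the compiled expression takes. -/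
def cost (w : ℕ) (m : ℕ → ℕ) : Expr → (ℕ → ℕ) → ℕ
  | var _, _ => 2
  | lit _, _ => 1
  | op _ e f, ρ => e.cost w m ρ + f.cost w m ρ + 1
  | load e, ρ => e.cost w m ρ + 1
  | fold _ _ i b e, ρ => b.cost w m ρ + 4 +
      ∑ k ∈ Finset.range (b.eval w m ρ), (e.cost w m (Function.update ρ i k) + 7) + 4

/-- Code for an expression, to be placed at position `p` of a program (jumps are absolute). The
variable `i` lives in register `2 * i`; the odd registers from `2 * d + 1` on are free, and the
value is left in register `2 * d + 1`. In a `fold`, the registers `2 * d + 1`, `2 * (d + 1) + 1`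
and `2 * (d + 2) + 1` hold the number of iterations still to be made, the former value of the
variable `i`, and the accumulated value. A constant `0` followed by a jump that tests it is an
unconditional jump. -/
def compile : Expr → ℕ → ℕ → Program
  | var i, _, d => [.const (2 * d + 1) 0, .arith .add (2 * d + 1) (2 * d + 1) (2 * i)]
  | lit a, _, d => [.const (2 * d + 1) a]
  | op o e f, p, d =>
      let E := e.compile p d
      let F := f.compile (p + E.length) (d + 1)
      E ++ (F ++ [.arith o (2 * d + 1) (2 * d + 1) (2 * (d + 1) + 1)])
  | load e, p, d => e.compile p d ++ [.load (2 * d + 1) (2 * d + 1)]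
  | fold o a i b e, p, d =>
      let B := b.compile p d
      let E := e.compile (p + B.length + 5) (d + 3)
      B ++ ([.const (2 * (d + 1) + 1) 0,
        .arith .add (2 * (d + 1) + 1) (2 * (d + 1) + 1) (2 * i),
        .const (2 * (d + 2) + 1) a,
        .const (2 * i) 0,
        .jumpZero (2 * d + 1) (p + B.length + 5 + E.length + 6)] ++
      (E ++ [.arith o (2 * (d + 2) + 1) (2 * (d + 2) + 1) (2 * (d + 3) + 1),
        .const (2 * (d + 3) + 1) 1,
        .arith .add (2 * i) (2 * i) (2 * (d + 3) + 1),
        .arith .sub (2 * d + 1) (2 * d + 1) (2 * (d + 3) + 1),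
        .const (2 * (d + 3) + 1) 0,
        .jumpZero (2 * (d + 3) + 1) (p + B.length + 4),
        .const (2 * d + 1) 0,
        .arith .add (2 * i) (2 * d + 1) (2 * (d + 1) + 1),
        .arith .add (2 * d + 1) (2 * d + 1) (2 * (d + 2) + 1)]))

theorem eval_lt {w : ℕ} {m ρ : ℕ → ℕ} (hρ : ∀ i, ρ i < 2 ^ w) (e : Expr) :
    e.eval w m ρ < 2 ^ w := by
  have h : 0 < 2 ^ w := by positivity
  cases e with
  | var i => exact hρ i
  | lit a => exact Nat.mod_lt _ h
  | op o e f => exact Nat.mod_lt _ h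
  | load e => exact Nat.mod_lt _ h
  | fold o a i b e =>
    rw [eval]
    generalize eval w m b ρ = N
    cases N <;> exact Nat.mod_lt _ h

end Expr

/-- `P` contains the instructions `c` from position `p` on. -/
def CodeAt (P : Program) (p : ℕ) : Program → Prop
  | [] => True
  | I :: c => P[p]? = some I ∧ CodeAt P (p + 1) c

theorem codeAt_append {P : Program} {p : ℕ} {c c' : Program} :
    CodeAt P p (c ++ c') ↔ CodeAt P p c ∧ CodeAt P (p + c.length) c' := by
  induction c generalizing p with
  | nil => simp [CodeAt]
  | cons I c ih =>
    simp only [List.cons_append, CodeAt, ih, List.length_cons, and_assoc]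
    rw [show p + 1 + c.length = p + (c.length + 1) by ring]

theorem codeAt_self (P : Program) : CodeAt P 0 P := by
  have key : ∀ (c pre : Program), CodeAt (pre ++ c) pre.length c := by
    intro c
    induction c with
    | nil => intro pre; trivial
    | cons I c ih =>
      intro pre
      refine ⟨by simp, ?_⟩
      simpa using ih (pre ++ [I])
  exact key P []

/-- The machine gets from `s` to `s'` in exactly `k` steps. -/
def Reach (P : Program) (w k : ℕ) (s s' : Config) : Prop := (step P w)^[k] s = s'

theorem Reach.refl (P : Program) (w : ℕ) (s : Config) : Reach P w 0 s s := rfl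

theorem Reach.trans {P : Program} {w k k' : ℕ} {s s' s'' : Config} (h : Reach P w k s s')
    (h' : Reach P w k' s' s'') : Reach P w (k + k') s s'' := by
  unfold Reach at *
  rw [add_comm, Function.iterate_add_apply, h, h']

theorem Reach.step {P : Program} {w k : ℕ} {s s' : Config} {I : Instr} (hI : P[s.pc]? = some I)
    (h : Reach P w k (exec w s I) s') : Reach P w (k + 1) s s' := by
  unfold Reach at *
  rw [Function.iterate_succ_apply, WordRAM.step, hI]
  exact h

theorem Reach.single {P : Program} {w : ℕ} {s : Config} {I : Instr} (hI : P[s.pc]? = some I) :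
    Reach P w 1 s (exec w s I) := Reach.step hI (Reach.refl _ _ _)

/-- The compiled expression computes the value in `cost` many steps, and it changes neither the
memory nor the variables nor the registers below the free ones. A `fold` overwrites its bound
variable while it runs and restores it at the end. -/
theorem Expr.reach {P : Program} {w : ℕ} (hw : 1 ≤ w) (m : ℕ → ℕ) (e : Expr) :
    ∀ (p d : ℕ) (ρ r : ℕ → ℕ), CodeAt P p (e.compile p d) → (∀ i, r (2 * i) = ρ i) →
      (∀ i, ρ i < 2 ^ w) → ∃ r' : ℕ → ℕ,
        Reach P w (e.cost w m ρ) ⟨p, r, m⟩ ⟨p + (e.compile p d).length, r', m⟩ ∧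
        (∀ i, r' (2 * i) = ρ i) ∧ (∀ j < d, r' (2 * j + 1) = r (2 * j + 1)) ∧
        r' (2 * d + 1) = e.eval w m ρ := by
  have h1 : 1 % 2 ^ w = 1 := Nat.mod_eq_of_lt (Nat.one_lt_two_pow (by omega))
  have ho : ∀ i j : ℕ, 2 * i ≠ 2 * j + 1 := by intros; omega
  have ho' : ∀ i j : ℕ, 2 * j + 1 ≠ 2 * i := by intros; omega
  induction e with
  | var i =>
    intro p d ρ r hc hr hρ
    obtain ⟨c1, c2, -⟩ := hc
    refine ⟨_, Reach.step c1 (Reach.step c2 (Reach.refl _ _ _)), ?_, ?_, ?_⟩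
    · intro k; simp [exec, ho, hr]
    · intro j hj; simp [exec, Function.update_apply, show j ≠ d by omega]
    · simp [exec, ho, hr, BinOp.eval, eval, Nat.mod_eq_of_lt (hρ i)]
  | lit a =>
    intro p d ρ r hc hr hρ
    obtain ⟨c1, -⟩ := hc
    refine ⟨_, Reach.step c1 (Reach.refl _ _ _), ?_, ?_, ?_⟩
    · intro k; simp [ho, hr]
    · intro j hj; simp [show j ≠ d by omega]
    · simp [eval]
  | op o e f ihe ihf =>
    intro p d ρ r hc hr hρ
    simp only [compile, codeAt_append] at hc
    obtain ⟨ce, cf, c1, -⟩ := hc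
    obtain ⟨r1, R1, hr1, ht1, hv1⟩ := ihe p d ρ r ce hr hρ
    obtain ⟨r2, R2, hr2, ht2, hv2⟩ := ihf _ (d + 1) ρ r1 cf hr1 hρ
    refine ⟨Function.update r2 (2 * d + 1) (o.eval (e.eval w m ρ) (f.eval w m ρ) % 2 ^ w),
      ?_, ?_, ?_, ?_⟩
    · have := (R1.trans R2).trans (Reach.single c1)
      simp only [exec, hv2, ht2 d (by omega), hv1] at this
      simpa only [cost, compile, List.length_append, List.length_cons, List.length_nil,
        ← add_assoc, zero_add] using this
    · intro k; simp [ho, hr2]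
    · intro j hj
      simp [show j ≠ d by omega, ht2 j (by omega), ht1 j hj]
    · simp [eval]
  | load e ih =>
    intro p d ρ r hc hr hρ
    simp only [compile, codeAt_append] at hc
    obtain ⟨ce, c1, -⟩ := hc
    obtain ⟨r1, R1, hr1, ht1, hv1⟩ := ih p d ρ r ce hr hρ
    refine ⟨Function.update r1 (2 * d + 1) (m (e.eval w m ρ) % 2 ^ w), ?_, ?_, ?_, ?_⟩
    · have := R1.trans (Reach.single c1)
      simp only [exec, hv1] at this
      simpa only [cost, compile, List.length_append, List.length_cons, List.length_nil,
        ← add_assoc, zero_add] using this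
    · intro k; simp [ho, hr1]
    · intro j hj
      simp [show j ≠ d by omega, ht1 j hj]
    · simp [eval]
  | fold o a i b e ihb ihe =>
    intro p d ρ r hc hr hρ
    simp only [compile, codeAt_append] at hc
    obtain ⟨cb, ⟨c1, c2, c3, c4, c5, -⟩, ce, e1, e2, e3, e4, e5, e6, e7, e8, e9, -⟩ := hc
    obtain ⟨r1, R1, hr1, ht1, hv1⟩ := ihb p d ρ r cb hr hρ
    have hN := eval_lt (m := m) hρ b
    set N := b.eval w m ρ with hNdef
    set acc : ℕ → ℕ := fun k => Nat.rec (a % 2 ^ w)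
      (fun k r => o.eval r (e.eval w m (Function.update ρ i k)) % 2 ^ w) k with hacc
    set q := p + (b.compile p d).length with hq
    simp only [List.length_cons, List.length_nil, zero_add] at ce e1 e2 e3 e4 e5 e6 e7 e8 e9
    -- the invariant at the head of the loop
    have loop : ∀ k ≤ N, ∃ r' : ℕ → ℕ,
        Reach P w (b.cost w m ρ + 4 +
          ∑ k ∈ Finset.range k, (e.cost w m (Function.update ρ i k) + 7)) ⟨p, r, m⟩
          ⟨q + 4, r', m⟩ ∧
        (∀ x, r' (2 * x) = Function.update ρ i k x) ∧
        (∀ j < d, r' (2 * j + 1) = r (2 * j + 1)) ∧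
        r' (2 * d + 1) = N - k ∧ r' (2 * (d + 1) + 1) = ρ i ∧ r' (2 * (d + 2) + 1) = acc k := by
      intro k
      induction k with
      | zero =>
        intro _
        refine ⟨_, R1.trans (Reach.step c1 (Reach.step c2 (Reach.step c3
          (Reach.step c4 (Reach.refl _ _ _))))),
          ?_, ?_, ?_, ?_, ?_⟩
        · intro x
          by_cases hx : x = i <;> simp [exec, Function.update_apply, ho, hr1, hx]
        · intro j hj
          simp [exec, Function.update_apply, ho', ht1 j hj, show j ≠ d + 2 by omega,
            show j ≠ d + 1 by omega]
        · simp [exec, Function.update_apply, ho', hv1]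
        · simp [exec, ho', ho, hr1, BinOp.eval, Nat.mod_eq_of_lt (hρ i)]
        · simp [exec, Function.update_apply, ho', hacc]
      | succ k ih =>
        intro hk
        obtain ⟨r', R, hr', ht', hn', hs', ha'⟩ := ih (by omega)
        have hρ' : ∀ x, Function.update ρ i k x < 2 ^ w := by
          intro x
          by_cases hx : x = i
          · subst hx; simp; omega
          · simpa [exec, Function.update_apply, hx] using hρ x
        have Rj : Reach P w 1 ⟨q + 4, r', m⟩ ⟨q + 5, r', m⟩ := by
          have := Reach.single (w := w) (s := ⟨q + 4, r', m⟩) c5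
          simpa [exec, hn', show N - k ≠ 0 by omega] using this
        obtain ⟨r2, R2, hr2, ht2, hv2⟩ := ihe _ (d + 3) _ r' ce hr' hρ'
        have := ((R.trans Rj).trans R2).trans (Reach.step e1 (Reach.step e2 (Reach.step e3
          (Reach.step e4 (Reach.step e5 (Reach.single e6))))))
        have hd0 : r2 (2 * d + 1) = N - k := by rw [ht2 d (by omega), hn']
        have hd1 : r2 (2 * (d + 1) + 1) = ρ i := by rw [ht2 (d + 1) (by omega), hs']
        have hd2 : r2 (2 * (d + 2) + 1) = acc k := by rw [ht2 (d + 2) (by omega), ha']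
        simp only [exec, Function.update_self, Nat.zero_mod, if_true] at this
        refine ⟨_, by
          rw [Finset.sum_range_succ]
          convert this using 1
          ring, ?_, ?_, ?_, ?_, ?_⟩
        · intro x
          by_cases hx : x = i
          · subst hx
            simp [Function.update_apply, ho, hr2, BinOp.eval, h1,
              Nat.mod_eq_of_lt (show k + 1 < 2 ^ w by omega)]
          · simp [Function.update_apply, ho, hr2, hx]
        · intro j hj
          simp [Function.update_apply, ho', ht2 j (by omega), ht' j hj, show j ≠ d by omega,
            show j ≠ d + 2 by omega, show j ≠ d + 3 by omega]
        · simp [Function.update_apply, ho', hd0, BinOp.eval, h1,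
            Nat.sub_sub,
            Nat.mod_eq_of_lt (show N - (k + 1) < 2 ^ w by omega)]
        · simpa [exec, Function.update_apply, ho'] using hd1
        · simp [Function.update_apply, ho', hd2, hv2, hacc]
    obtain ⟨r', R, hr', ht', hn', hs', ha'⟩ := loop N le_rfl
    have := R.trans (Reach.step c5 (by
      simp only [exec, hn', Nat.sub_self, if_true]
      exact Reach.step e7 (Reach.step e8 (Reach.single e9))))
    refine ⟨_, by
      simp only [cost, compile, List.length_append, List.length_cons, List.length_nil]
      convert this using 1
      simp only [exec]
      congr 1
      rw [← hq]
      omega, ?_, ?_, ?_⟩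
    · intro x
      by_cases hx : x = i
      · subst hx
        simp [Function.update_apply, ho, hs', BinOp.eval, Nat.mod_eq_of_lt (hρ _)]
      · simp [Function.update_apply, ho, hr', hx]
    · intro j hj
      simp [ho', ht' j hj, show j ≠ d by omega]
    · have hlt : acc N < 2 ^ w := eval_lt (m := m) hρ (fold o a i b e)
      simp [ho', ha', BinOp.eval, Nat.mod_eq_of_lt hlt]
      rfl

/-- The state of a run of a command: the values of the variables and the contents of the
memory. -/
@[ext]
structure Store where
  var : ℕ → ℕ
  mem : ℕ → ℕ

/-- The store with a new value of one variable. -/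
def Store.set (s : Store) (i a : ℕ) : Store := ⟨Function.update s.var i a, s.mem⟩

/-- Commands. `assign x e` sets the variable `x`, `write a e` writes into the memory cell whose
address is the value of `a`, and `loop i b c` executes `c` with `i` set to `0`, `1`, … up to
(but excluding) the value of `b` at the beginning. -/
inductive Cmd
  | assign (x : ℕ) (e : Expr)
  | write (a e : Expr)
  | seq (c c' : Cmd)
  | loop (i : ℕ) (b : Expr) (c : Cmd)

namespace Cmd

/-- The store after the execution of a command with `w`-bit words. -/
def run (w : ℕ) : Cmd → Store → Store
  | assign x e, s => s.set x (e.eval w s.mem s.var)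
  | write a e, s => ⟨s.var, Function.update s.mem (a.eval w s.mem s.var) (e.eval w s.mem s.var)⟩
  | seq c c', s => c'.run w (c.run w s)
  | loop i b c, s => Nat.rec s (fun k s' => c.run w (s'.set i k)) (b.eval w s.mem s.var)

/-- The number of steps that the compiled command takes. -/
def time (w : ℕ) : Cmd → Store → ℕ
  | assign _ e, s => e.cost w s.mem s.var + 2
  | write a e, s => a.cost w s.mem s.var + e.cost w s.mem s.var + 1
  | seq c c', s => c.time w s + c'.time w (c.run w s)
  | loop i b c, s => b.cost w s.mem s.var + 1 +
      ∑ k ∈ Finset.range (b.eval w s.mem s.var),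
        (c.time w (Store.set (Nat.rec s (fun k s' => c.run w (s'.set i k)) k) i k) + 8) + 1

/-- Code for a command, to be placed at position `p` of a program; the odd registers from
`2 * d + 1` on are free. In a `loop`, the registers `2 * d + 1` and `2 * (d + 1) + 1` hold the
number of iterations still to be made and the number of those already made. -/
def compile : Cmd → ℕ → ℕ → Program
  | assign x e, p, d => e.compile p d ++
      [.const (2 * x) 0, .arith .add (2 * x) (2 * x) (2 * d + 1)]
  | write a e, p, d =>
      let A := a.compile p d
      let E := e.compile (p + A.length) (d + 1)
      A ++ (E ++ [.store (2 * d + 1) (2 * (d + 1) + 1)])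
  | seq c c', p, d =>
      let C := c.compile p d
      C ++ c'.compile (p + C.length) d
  | loop i b c, p, d =>
      let B := b.compile p d
      let C := c.compile (p + B.length + 4) (d + 2)
      B ++ ([.const (2 * (d + 1) + 1) 0,
        .jumpZero (2 * d + 1) (p + B.length + 4 + C.length + 5),
        .const (2 * i) 0,
        .arith .add (2 * i) (2 * i) (2 * (d + 1) + 1)] ++
      (C ++ [.const (2 * (d + 2) + 1) 1,
        .arith .add (2 * (d + 1) + 1) (2 * (d + 1) + 1) (2 * (d + 2) + 1),
        .arith .sub (2 * d + 1) (2 * d + 1) (2 * (d + 2) + 1),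
        .const (2 * (d + 2) + 1) 0,
        .jumpZero (2 * (d + 2) + 1) (p + B.length + 1)]))

/-- The compiled command has the effect that `run` describes, in exactly `time` many steps. -/
theorem reach {P : Program} {w : ℕ} (hw : 1 ≤ w) (c : Cmd) :
    ∀ (p d : ℕ) (s : Store) (r : ℕ → ℕ), CodeAt P p (c.compile p d) →
      (∀ i, r (2 * i) = s.var i) → (∀ i, s.var i < 2 ^ w) → ∃ r' : ℕ → ℕ,
        Reach P w (c.time w s) ⟨p, r, s.mem⟩
          ⟨p + (c.compile p d).length, r', (c.run w s).mem⟩ ∧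
        (∀ i, r' (2 * i) = (c.run w s).var i) ∧ (∀ i, (c.run w s).var i < 2 ^ w) ∧
        ∀ j < d, r' (2 * j + 1) = r (2 * j + 1) := by
  have h1 : 1 % 2 ^ w = 1 := Nat.mod_eq_of_lt (Nat.one_lt_two_pow (by omega))
  have ho : ∀ i j : ℕ, 2 * i ≠ 2 * j + 1 := by intros; omega
  have ho' : ∀ i j : ℕ, 2 * j + 1 ≠ 2 * i := by intros; omega
  have hset : ∀ (s : Store) (i a : ℕ), (∀ x, s.var x < 2 ^ w) → a < 2 ^ w →
      ∀ x, (s.set i a).var x < 2 ^ w := by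
    intro s i a hs ha x
    by_cases hx : x = i
    · subst hx; simpa [Store.set] using ha
    · simpa [Store.set, Function.update_apply, hx] using hs x
  induction c with
  | assign x e =>
    intro p d s r hc hr hs
    simp only [compile, codeAt_append] at hc
    obtain ⟨ce, c1, c2, -⟩ := hc
    obtain ⟨r1, R1, hr1, ht1, hv1⟩ := Expr.reach hw s.mem e p d s.var r ce hr hs
    have he := Expr.eval_lt (m := s.mem) hs e
    refine ⟨_, by
      have := R1.trans (Reach.step c1 (Reach.step c2 (Reach.refl _ _ _)))
      simp only [compile, time, List.length_append, List.length_cons, List.length_nil,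
        ← add_assoc, zero_add]
      exact this, ?_, hset s x _ hs he, ?_⟩
    · intro k
      by_cases hx : k = x
      · subst hx
        simp [exec, run, Store.set, BinOp.eval, ho', hv1, Nat.mod_eq_of_lt he]
      · simp [exec, run, Store.set, Function.update_apply, hx, hr1]
    · intro j hj
      simp [exec, ho', ht1 j hj]
  | write a e =>
    intro p d s r hc hr hs
    simp only [compile, codeAt_append] at hc
    obtain ⟨ca, ce, c1, -⟩ := hc
    obtain ⟨r1, R1, hr1, ht1, hv1⟩ := Expr.reach hw s.mem a p d s.var r ca hr hs
    obtain ⟨r2, R2, hr2, ht2, hv2⟩ := Expr.reach hw s.mem e _ (d + 1) s.var r1 ce hr1 hs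
    refine ⟨r2, ?_, hr2, hs, fun j hj => by rw [ht2 j (by omega), ht1 j hj]⟩
    have := (R1.trans R2).trans (Reach.single c1)
    simp only [exec, hv2, ht2 d (by omega), hv1] at this
    simpa only [time, run, compile, List.length_append, List.length_cons, List.length_nil,
      ← add_assoc, zero_add] using this
  | seq c c' ih ih' =>
    intro p d s r hc hr hs
    simp only [compile, codeAt_append] at hc
    obtain ⟨r1, R1, hr1, hs1, ht1⟩ := ih p d s r hc.1 hr hs
    obtain ⟨r2, R2, hr2, hs2, ht2⟩ := ih' _ d _ r1 hc.2 hr1 hs1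
    refine ⟨r2, ?_, hr2, hs2, fun j hj => by rw [ht2 j hj, ht1 j hj]⟩
    simpa only [compile, time, run, List.length_append, ← add_assoc] using R1.trans R2
  | loop i b c ih =>
    intro p d s r hc hr hs
    simp only [compile, codeAt_append] at hc
    obtain ⟨cb, ⟨c1, c2, c3, c4, -⟩, ce, e1, e2, e3, e4, e5, -⟩ := hc
    obtain ⟨r1, R1, hr1, ht1, hv1⟩ := Expr.reach hw s.mem b p d s.var r cb hr hs
    have hN := Expr.eval_lt (m := s.mem) hs b
    set N := b.eval w s.mem s.var with hNdef
    set S : ℕ → Store := fun k => Nat.rec s (fun k s' => c.run w (s'.set i k)) k with hS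
    set q := p + (b.compile p d).length with hq
    simp only [List.length_cons, List.length_nil, zero_add] at ce e1 e2 e3 e4 e5
    -- the invariant at the head of the loop
    have loop : ∀ k ≤ N, ∃ r' : ℕ → ℕ,
        Reach P w (b.cost w s.mem s.var + 1 +
          ∑ k ∈ Finset.range k, (c.time w ((S k).set i k) + 8)) ⟨p, r, s.mem⟩
          ⟨q + 1, r', (S k).mem⟩ ∧
        (∀ x, r' (2 * x) = (S k).var x) ∧ (∀ x, (S k).var x < 2 ^ w) ∧
        (∀ j < d, r' (2 * j + 1) = r (2 * j + 1)) ∧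
        r' (2 * d + 1) = N - k ∧ r' (2 * (d + 1) + 1) = k := by
      intro k
      induction k with
      | zero =>
        intro _
        refine ⟨_, R1.trans (Reach.step c1 (Reach.refl _ _ _)), ?_, hs, ?_, ?_, ?_⟩
        · intro x
          simp [ho, hr1, hS]
        · intro j hj
          simp [ht1 j hj, show j ≠ d + 1 by omega]
        · simp [hv1]
        · simp
      | succ k ihk =>
        intro hk
        obtain ⟨r', R, hr', hs', ht', hn', hk'⟩ := ihk (by omega)
        have Rj : Reach P w 3 ⟨q + 1, r', (S k).mem⟩
            ⟨q + 4, Function.update r' (2 * i) k, (S k).mem⟩ := by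
          have := Reach.step (w := w) (s := ⟨q + 1, r', (S k).mem⟩) c2 (by
            simp only [exec, hn', show N - k ≠ 0 by omega, if_false]
            exact Reach.step c3 (Reach.step c4 (Reach.refl _ _ _)))
          simpa [exec, hk', BinOp.eval, ho', Nat.mod_eq_of_lt (show k < 2 ^ w by omega)]
            using this
        obtain ⟨r2, R2, hr2, hs2, ht2⟩ := ih _ (d + 2) ((S k).set i k)
          (Function.update r' (2 * i) k) ce (by
            intro x
            by_cases hx : x = i <;> simp [Store.set, hx, hr'])
          (hset _ _ _ hs' (by omega))
        have := ((R.trans Rj).trans R2).trans (Reach.step e1 (Reach.step e2 (Reach.step e3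
          (Reach.step e4 (Reach.single e5)))))
        have hd0 : r2 (2 * d + 1) = N - k := by
          rw [ht2 d (by omega), Function.update_of_ne (ho' _ _), hn']
        have hd1 : r2 (2 * (d + 1) + 1) = k := by
          rw [ht2 (d + 1) (by omega), Function.update_of_ne (ho' _ _), hk']
        simp only [exec, Function.update_self, Nat.zero_mod, if_true] at this
        refine ⟨_, by
          rw [Finset.sum_range_succ]
          convert this using 1
          ring, ?_, hs2, ?_, ?_, ?_⟩
        · intro x
          simp [ho, hr2, hS]
        · intro j hj
          simp [ho', ht2 j (by omega), ht' j hj, show j ≠ d by omega,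
            show j ≠ d + 1 by omega, show j ≠ d + 2 by omega]
        · simp [hd0, BinOp.eval, h1, Nat.sub_sub,
            Nat.mod_eq_of_lt (show N - (k + 1) < 2 ^ w by omega)]
        · simp [hd1, BinOp.eval, h1,
            Nat.mod_eq_of_lt (show k + 1 < 2 ^ w by omega)]
    obtain ⟨r', R, hr', hs', ht', hn', -⟩ := loop N le_rfl
    have := R.trans (Reach.single c2)
    simp only [exec, hn', Nat.sub_self, if_true] at this
    refine ⟨r', ?_, hr', hs', ht'⟩
    simp only [time, compile, List.length_append, List.length_cons, List.length_nil]
    convert this using 1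
    simp only [Config.mk.injEq, true_and]
    rw [← hq]
    exact ⟨by omega, rfl⟩

/-- A compiled command is a program of the machine, with the variable `0` as its output. -/
theorem computesWithin {w : ℕ} (hw : 1 ≤ w) (c : Cmd) (x : List ℕ) :
    ComputesWithin (c.compile 0 0) w x (c.time w ⟨fun _ => 0, fun a => x.getD a 0 % 2 ^ w⟩)
      ((c.run w ⟨fun _ => 0, fun a => x.getD a 0 % 2 ^ w⟩).var 0) := by
  obtain ⟨r', R, hr', -, -⟩ := reach hw c 0 0 ⟨fun _ => 0, fun a => x.getD a 0 % 2 ^ w⟩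
    (fun _ => 0) (codeAt_self _) (fun _ => rfl) (fun _ => by positivity)
  refine ⟨_, le_rfl, ?_, ?_⟩
  · rw [show (step _ w)^[_] (init w x) = _ from R]
    simp
  · rw [show (step _ w)^[_] (init w x) = _ from R]
    simpa using hr' 0

theorem run_seq {w : ℕ} {s : Store} (c c' : Cmd) :
    (c.seq c').run w s = c'.run w (c.run w s) := rfl

theorem time_seq {w : ℕ} {s : Store} (c c' : Cmd) :
    (c.seq c').time w s = c.time w s + c'.time w (c.run w s) := rfl

/-- The rule for loops: an invariant together with a bound on the time of each iteration. -/
theorem loop_spec {w i N : ℕ} {b : Expr} {c : Cmd} {s : Store} (Inv : ℕ → Store → Prop)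
    (τ : ℕ → ℕ) (hb : b.eval w s.mem s.var = N) (h0 : Inv 0 s)
    (hstep : ∀ k < N, ∀ s', Inv k s' →
      Inv (k + 1) (c.run w (s'.set i k)) ∧ c.time w (s'.set i k) ≤ τ k) :
    Inv N ((loop i b c).run w s) ∧
      (loop i b c).time w s ≤ b.cost w s.mem s.var + 2 + ∑ k ∈ Finset.range N, (τ k + 8) := by
  have inv : ∀ k ≤ N, Inv k (Nat.rec s (fun k s' => c.run w (s'.set i k)) k) := by
    intro k
    induction k with
    | zero => exact fun _ => h0
    | succ k ih => exact fun hk => (hstep k (by omega) _ (ih (by omega))).1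
  refine ⟨by simpa only [run, hb] using inv N le_rfl, ?_⟩
  have : ∑ k ∈ Finset.range N,
      (c.time w (Store.set (Nat.rec s (fun k s' => c.run w (s'.set i k)) k) i k) + 8) ≤
      ∑ k ∈ Finset.range N, (τ k + 8) := by
    refine Finset.sum_le_sum fun k hk => ?_
    have := (hstep k (Finset.mem_range.1 hk) _ (inv k (Finset.mem_range.1 hk).le)).2
    omega
  simp only [time, hb]
  omega

end Cmd

end WordRAM

/-! ### The left-covering number and the half-ordering asymmetry -/

@[simp]
theorem coMatching_black_inl_inr {t : ℕ} (i j : Fin t) :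
    (coMatching t).black.Adj (.inl i) (.inr j) ↔ i ≠ j := by
  simp [coMatching]

@[simp]
theorem coMatching_black_inr_inl {t : ℕ} (i j : Fin t) :
    (coMatching t).black.Adj (.inr i) (.inl j) ↔ i ≠ j := by
  rw [SimpleGraph.adj_comm, coMatching_black_inl_inr, ne_comm]

@[simp]
theorem coMatching_not_black_inl_inl {t : ℕ} (i j : Fin t) :
    ¬ (coMatching t).black.Adj (.inl i) (.inl j) := by
  simp [coMatching]

@[simp]
theorem coMatching_not_black_inr_inr {t : ℕ} (i j : Fin t) :
    ¬ (coMatching t).black.Adj (.inr i) (.inr j) := by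
  simp [coMatching]

@[simp]
theorem coMatching_red_inl_inr {t : ℕ} (i j : Fin t) :
    (coMatching t).red.Adj (.inl i) (.inr j) ↔ i = j := by
  simp [coMatching, eq_comm]

@[simp]
theorem coMatching_red_inr_inl {t : ℕ} (i j : Fin t) :
    (coMatching t).red.Adj (.inr i) (.inl j) ↔ i = j := by
  rw [SimpleGraph.adj_comm, coMatching_red_inl_inr, eq_comm]

@[simp]
theorem coMatching_not_red_inl_inl {t : ℕ} (i j : Fin t) :
    ¬ (coMatching t).red.Adj (.inl i) (.inl j) := by
  simp [coMatching]

@[simp]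
theorem coMatching_not_red_inr_inr {t : ℕ} (i j : Fin t) :
    ¬ (coMatching t).red.Adj (.inr i) (.inr j) := by
  simp [coMatching]

@[simp]
theorem inl_mem_coMatchingX {t : ℕ} (i : Fin t) : .inl i ∈ coMatchingX t := by
  simp [coMatchingX]

@[simp]
theorem inr_notMem_coMatchingX {t : ℕ} (i : Fin t) : .inr i ∉ coMatchingX t := by
  simp [coMatchingX]

@[simp]
theorem inr_mem_coMatchingY {t : ℕ} (i : Fin t) : .inr i ∈ coMatchingY t := by
  simp [coMatchingY]

@[simp]
theorem inl_notMem_coMatchingY {t : ℕ} (i : Fin t) : .inl i ∉ coMatchingY t := by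
  simp [coMatchingY]

/-- The last vertex together with its red partner is a left-cover: the last vertex is joined by
black edges to the whole opposite side except for its partner. -/
theorem exists_isLeftCover_coMatching {t : ℕ} (ht : 1 ≤ t) (o : LinearOrder (Fin t ⊕ Fin t)) :
    ∃ C : Finset (Fin t ⊕ Fin t),
      (coMatching t).IsLeftCover o (coMatchingX t) (coMatchingY t) C ∧ C.card = 2 := by
  have hne : (Finset.univ : Finset (Fin t ⊕ Fin t)).Nonempty := ⟨.inl ⟨0, ht⟩, Finset.mem_univ _⟩
  obtain ⟨v, hv⟩ : ∃ v : Fin t ⊕ Fin t, ∀ u, u ≠ v → o.lt u v := by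
    obtain ⟨v, -, hv⟩ := @Finset.exists_max_image _ _ o Finset.univ id hne
    exact ⟨v, fun u hu => @lt_of_le_of_ne _ o.toPartialOrder _ _ (hv u (Finset.mem_univ _)) hu⟩
  rcases v with i | i
  · refine ⟨{.inl i, .inr i}, Or.inr ?_, by simp⟩
    rintro (j | j) hj
    · simp at hj
    · by_cases hij : i = j
      · exact Or.inr (by simp [hij])
      · refine Or.inl ?_
        simp only [Set.mem_iUnion]
        exact ⟨.inl i, by simp, by simpa using hij, hv _ (by simp)⟩
  · refine ⟨{.inl i, .inr i}, Or.inl ?_, by simp⟩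
    rintro (j | j) hj
    · by_cases hij : i = j
      · exact Or.inr (by simp [hij])
      · refine Or.inl ?_
        simp only [Set.mem_iUnion]
        exact ⟨.inr i, by simp, by simpa using hij, hv _ (by simp)⟩
    · simp at hj

/-- A single vertex covers neither its own side, in which it has no neighbours, nor the opposite
side, which contains its red partner. -/
theorem two_le_card_of_isLeftCover_coMatching {t : ℕ} (ht : 2 ≤ t)
    (o : LinearOrder (Fin t ⊕ Fin t)) {C : Finset (Fin t ⊕ Fin t)}
    (hC : (coMatching t).IsLeftCover o (coMatchingX t) (coMatchingY t) C) : 2 ≤ C.card := by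
  have : Nontrivial (Fin t) := Fin.nontrivial_iff_two_le.2 ht
  by_contra! hlt
  obtain ⟨c, hc⟩ : ∃ c, C ⊆ {c} := by
    rcases C.eq_empty_or_nonempty with h | ⟨c, hc⟩
    · exact ⟨.inl ⟨0, by omega⟩, by simp [h]⟩
    · exact ⟨c, fun x hx => Finset.mem_singleton.2 (Finset.card_le_one.1 (by omega) x hx c hc)⟩
  have key : ∀ x, x ∈ (⋃ c ∈ C, (coMatching t).leftNeighbors o c) ∪ (C : Set (Fin t ⊕ Fin t)) →
      (coMatching t).black.Adj c x ∨ x = c := by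
    rintro x (hx | hx)
    · simp only [Set.mem_iUnion] at hx
      obtain ⟨c', hc', hx⟩ := hx
      rw [Finset.mem_singleton.1 (hc hc')] at hx
      exact Or.inl hx.1
    · exact Or.inr (Finset.mem_singleton.1 (hc hx))
  rcases c with i | i
  · obtain ⟨j, hj⟩ := exists_ne i
    rcases hC with hC | hC
    · simpa [hj] using key _ (hC (Finset.mem_coe.2 (inl_mem_coMatchingX j)))
    · simpa using key _ (hC (Finset.mem_coe.2 (inr_mem_coMatchingY i)))
  · obtain ⟨j, hj⟩ := exists_ne i
    rcases hC with hC | hC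
    · simpa using key _ (hC (Finset.mem_coe.2 (inl_mem_coMatchingX i)))
    · simpa [hj] using key _ (hC (Finset.mem_coe.2 (inr_mem_coMatchingY j)))

theorem leftCoveringNumber_coMatching {t : ℕ} (ht : 2 ≤ t) :
    (coMatching t).leftCoveringNumber (coMatchingX t) (coMatchingY t) = 2 := by
  have : Nonempty (LinearOrder (Fin t ⊕ Fin t)) := by
    classical exact ⟨linearOrderOfSTO WellOrderingRel⟩
  have h : ∀ o : LinearOrder (Fin t ⊕ Fin t),
      (coMatching t).orderedLeftCoveringNumber (coMatchingX t) (coMatchingY t) o = 2 := by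
    intro o
    obtain ⟨C, hC, hC2⟩ := exists_isLeftCover_coMatching (by omega) o
    refine le_antisymm (Nat.sInf_le ⟨C, hC, hC2⟩) ?_
    refine le_csInf ⟨2, C, hC, hC2⟩ ?_
    rintro k ⟨C', hC', rfl⟩
    exact two_le_card_of_isLeftCover_coMatching ht o hC'
  simp only [Pattern.leftCoveringNumber, h, ciSup_const]

/-- The side `Z` has only one class of orderings as soon as there is, for every vertex of `Z`,
exactly one vertex outside of `Z` that is joined to all of `Z` except for that vertex: whatever
the ordering, the signature consists of the complements of the singletons. -/
theorem Pattern.halfOrderingAsymmetrySide_eq_one {V : Type*} [Fintype V] [DecidableEq V]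
    {H : Pattern V} {Z : Finset V} (f : Z ≃ (Zᶜ : Finset V))
    (hf : ∀ z z' : Z, H.black.Adj (f z) z' ↔ z ≠ z') : H.halfOrderingAsymmetrySide Z = 1 := by
  have hsig : ∀ e : Fin Z.card ≃ Z,
      H.signature Z e = Finset.univ.val.map fun i : Fin Z.card => ({i}ᶜ : Set (Fin Z.card)) := by
    intro e
    have h1 : (Zᶜ : Finset V).val =
        (Finset.univ : Finset (Fin Z.card)).val.map fun i => (f (e i) : V) := by
      have : (Zᶜ : Finset V) = Finset.univ.map
          (((e.trans f).toEmbedding).trans (Function.Embedding.subtype _)) := by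
        ext u
        simp only [Finset.mem_map, Finset.mem_univ, true_and]
        constructor
        · intro hu
          exact ⟨(e.trans f).symm ⟨u, hu⟩, by simp⟩
        · rintro ⟨i, rfl⟩
          exact ((e.trans f) i).2
      exact (congrArg Finset.val this).trans rfl
    rw [Pattern.signature, h1, Multiset.map_map]
    refine Multiset.map_congr rfl fun i _ => ?_
    ext j
    simp [hf, eq_comm]
  have hsub : Subsingleton (Quotient (Setoid.ker (H.signature Z))) := by
    refine ⟨fun a b => ?_⟩
    induction a, b using Quotient.inductionOn₂ with
    | h a b => exact Quotient.sound (Setoid.ker_def.2 ((hsig a).trans (hsig b).symm))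
  have hne : Nonempty (Quotient (Setoid.ker (H.signature Z))) :=
    ⟨Quotient.mk _ Z.equivFin.symm⟩
  exact Nat.card_eq_one_iff_unique.2 ⟨hsub, hne⟩

/-- In the co-matching, the vertex outside of a side that misses exactly `z` is the red partner
of `z`. -/
theorem halfOrderingAsymmetry_coMatching (t : ℕ) :
    (coMatching t).halfOrderingAsymmetry (coMatchingX t) (coMatchingY t) = 1 := by
  have hX : (coMatching t).halfOrderingAsymmetrySide (coMatchingX t) = 1 := by
    refine Pattern.halfOrderingAsymmetrySide_eq_one
      ⟨fun z => ⟨z.1.swap, ?_⟩, fun z => ⟨z.1.swap, ?_⟩, ?_, ?_⟩ ?_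
    · rcases z with ⟨z | z, hz⟩ <;> simp at hz ⊢
    · rcases z with ⟨z | z, hz⟩ <;> simp at hz ⊢
    · rintro ⟨z, hz⟩; simp
    · rintro ⟨z, hz⟩; simp
    · rintro ⟨z | z, hz⟩ ⟨z' | z', hz'⟩ <;> simp at hz hz' ⊢
  have hY : (coMatching t).halfOrderingAsymmetrySide (coMatchingY t) = 1 := by
    refine Pattern.halfOrderingAsymmetrySide_eq_one
      ⟨fun z => ⟨z.1.swap, ?_⟩, fun z => ⟨z.1.swap, ?_⟩, ?_, ?_⟩ ?_
    · rcases z with ⟨z | z, hz⟩ <;> simp at hz ⊢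
    · rcases z with ⟨z | z, hz⟩ <;> simp at hz ⊢
    · rintro ⟨z, hz⟩; simp
    · rintro ⟨z, hz⟩; simp
    · rintro ⟨z | z, hz⟩ ⟨z' | z', hz'⟩ <;> simp at hz hz' ⊢
  rw [Pattern.halfOrderingAsymmetry, hX, hY, max_self]

/-! ### Counting co-matchings by ordered pairs of sides -/

/-- The automorphism of the co-matching that permutes the indices by `σ` and, if `b` is true,
exchanges the two sides. -/
def coMatchingAut {t : ℕ} (x : Equiv.Perm (Fin t) × Bool) : Equiv.Perm (Fin t ⊕ Fin t) :=
  if x.2 then (Equiv.sumCongr x.1 x.1).trans (Equiv.sumComm _ _) else Equiv.sumCongr x.1 x.1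

theorem isAutomorphism_coMatchingAut {t : ℕ} (x : Equiv.Perm (Fin t) × Bool) :
    (coMatching t).IsAutomorphism (coMatchingAut x) := by
  rcases x with ⟨σ, _ | _⟩ <;> constructor <;> rintro (u | u) (v | v) <;> simp [coMatchingAut]

theorem coMatchingAut_injective {t : ℕ} (ht : 1 ≤ t) :
    Function.Injective (coMatchingAut (t := t)) := by
  rintro ⟨σ, b⟩ ⟨τ, c⟩ h
  have h' := fun i : Fin t => DFunLike.congr_fun h (Sum.inl i)
  rcases b with _ | _ <;> rcases c with _ | _ <;> simp [coMatchingAut] at h' ⊢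
  · exact Equiv.ext h'
  · exact h' ⟨0, ht⟩
  · exact h' ⟨0, ht⟩
  · exact Equiv.ext h'

/-- An automorphism preserves white edges, hence the partition into sides, and red edges, hence
its action on one side determines that on the other. -/
theorem exists_eq_coMatchingAut {t : ℕ} (ht : 1 ≤ t) {α : Equiv.Perm (Fin t ⊕ Fin t)}
    (hα : (coMatching t).IsAutomorphism α) : ∃ x, coMatchingAut x = α := by
  have hred : ∀ i, (coMatching t).red.Adj (α (.inl i)) (α (.inr i)) := fun i =>
    (hα.2 _ _).2 (by simp)
  have hside : ∀ i j, (α (.inl i)).isLeft = (α (.inl j)).isLeft := by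
    intro i j
    by_contra hne
    have hb := (hα.1 (.inl i) (.inl j)).not.2 (by simp)
    have hr := (hα.2 (.inl i) (.inl j)).not.2 (by simp)
    rcases h : α (.inl i) with a | a <;> rcases h' : α (.inl j) with b | b <;>
      simp [h, h'] at hb hr hne
    · exact hr hb
    · exact hr hb
  have hinj : ∀ i j, α (.inl i) = α (.inl j) → i = j := fun i j h => by
    simpa using α.injective h
  rcases h0 : (α (.inl ⟨0, ht⟩)).isLeft with _ | _
  · have hR : ∀ i, ∃ j, α (.inl i) = .inr j := fun i =>
      Sum.isRight_iff.1 (by simpa [h0] using hside i ⟨0, ht⟩)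
    choose σ hσ using hR
    have hσi : Function.Injective σ := fun i j h => hinj i j (by rw [hσ, hσ, h])
    refine ⟨(Equiv.ofBijective σ (Finite.injective_iff_bijective.1 hσi), true), ?_⟩
    ext1 s
    rcases s with i | i
    · simp [coMatchingAut, hσ]
    · have := hred i
      rcases h : α (.inr i) with b | b <;> rw [hσ, h] at this <;> simp at this
      simp [coMatchingAut, this]
  · have hR : ∀ i, ∃ j, α (.inl i) = .inl j := fun i =>
      Sum.isLeft_iff.1 (by simpa [h0] using hside i ⟨0, ht⟩)
    choose σ hσ using hR
    have hσi : Function.Injective σ := fun i j h => hinj i j (by rw [hσ, hσ, h])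
    refine ⟨(Equiv.ofBijective σ (Finite.injective_iff_bijective.1 hσi), false), ?_⟩
    ext1 s
    rcases s with i | i
    · simp [coMatchingAut, hσ]
    · have := hred i
      rcases h : α (.inr i) with b | b <;> rw [hσ, h] at this <;> simp at this
      simp [coMatchingAut, this]

open Classical in
/-- The co-matchings in `G` whose vertices lie in `A`, as pairs of enumerations of the two sides.
The last condition says that red partners are distinct; all other pairs of vertices are distinct
because of the adjacencies. -/
noncomputable def coMatchingPairs {V : Type*} [Fintype V] (G : SimpleGraph V) (t : ℕ)
    (A : Finset V) : Finset ((Fin t → V) × (Fin t → V)) :=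
  {q | ((∀ i, q.1 i ∈ A) ∧ ∀ i, q.2 i ∈ A) ∧ (∀ i j, G.Adj (q.1 i) (q.2 j) ↔ i ≠ j) ∧
    ∀ i, q.1 i ≠ q.2 i}

section

variable {V : Type*} [Fintype V] {G : SimpleGraph V} {t : ℕ} {A : Finset V}

theorem mem_coMatchingPairs {q : (Fin t → V) × (Fin t → V)} :
    q ∈ coMatchingPairs G t A ↔ ((∀ i, q.1 i ∈ A) ∧ ∀ i, q.2 i ∈ A) ∧
      (∀ i j, G.Adj (q.1 i) (q.2 j) ↔ i ≠ j) ∧ ∀ i, q.1 i ≠ q.2 i := by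
  simp [coMatchingPairs]

/-- Vertices of the same side are distinct because their neighbourhoods in the other side
differ. -/
theorem sumElim_injective_of_mem_coMatchingPairs {q : (Fin t → V) × (Fin t → V)}
    (hq : q ∈ coMatchingPairs G t A) : Function.Injective (Sum.elim q.1 q.2) := by
  obtain ⟨-, hadj, hne⟩ := mem_coMatchingPairs.1 hq
  have hxy : ∀ i j, q.1 i ≠ q.2 j := by
    intro i j h
    by_cases hij : i = j
    · exact hne i (by rw [h, hij])
    · exact G.ne_of_adj ((hadj i j).2 hij) h
  rintro (i | i) (j | j) h <;> simp only [Sum.elim_inl, Sum.elim_inr] at h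
  · by_contra hij
    have := (hadj i j).2 (by simpa using hij)
    rw [h] at this
    exact (hadj j j).1 this rfl
  · exact (hxy _ _ h).elim
  · exact (hxy _ _ h.symm).elim
  · by_contra hij
    have := (hadj j i).2 (by simpa [eq_comm] using hij)
    rw [h] at this
    exact (hadj j j).1 this rfl

/-- An appearance of the co-matching is the same as a pair of enumerated sides. -/
noncomputable def appearanceEquiv (G : SimpleGraph V) (t : ℕ) :
    (coMatching t).Appearance G ≃ coMatchingPairs G t Finset.univ where
  toFun φ := ⟨(fun i => φ.1 (.inl i), fun i => φ.1 (.inr i)), by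
    refine mem_coMatchingPairs.2 ⟨by simp, fun i j => ?_, fun i => by simp⟩
    by_cases hij : i = j
    · simpa [hij] using φ.2.2 (.inl i) (.inr j) (by simp [hij])
    · simpa [hij] using φ.2.1 (.inl i) (.inr j) (by simp [hij])⟩
  invFun q := ⟨⟨Sum.elim q.1.1 q.1.2, sumElim_injective_of_mem_coMatchingPairs q.2⟩, by
    obtain ⟨-, hadj, -⟩ := mem_coMatchingPairs.1 q.2
    constructor
    · rintro (i | i) (j | j) h <;> simp at h ⊢
      · exact (hadj _ _).2 h
      · exact ((hadj _ _).2 (Ne.symm h)).symm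
    · rintro (i | i) (j | j) h <;> simp at h ⊢
      · simp [hadj, h]
      · simp [G.adj_comm, hadj, h]⟩
  left_inv φ := by
    apply Subtype.ext
    ext (i | i) <;> rfl
  right_inv q := rfl

/-- Every copy of the co-matching is enumerated by `2 * t !` pairs, one for every automorphism. -/
theorem card_coMatchingPairs_univ (G : SimpleGraph V) (ht : 1 ≤ t) :
    (coMatchingPairs G t Finset.univ).card = (coMatching t).count G * (2 * t.factorial) := by
  classical
  have : Finite ((coMatching t).Appearance G) := Finite.of_equiv _ (appearanceEquiv G t).symm
  have : Fintype (Quotient ((coMatching t).sameCopy G)) := Fintype.ofFinite _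
  rw [← Fintype.card_coe, ← Nat.card_eq_fintype_card, ← Nat.card_congr (appearanceEquiv G t),
    ← Nat.card_congr (Equiv.sigmaFiberEquiv (Quotient.mk ((coMatching t).sameCopy G))),
    Nat.card_sigma, Finset.sum_congr rfl (g := fun _ => 2 * t.factorial), Finset.sum_const,
    Finset.card_univ, smul_eq_mul, Pattern.count, Nat.card_eq_fintype_card]
  rintro c -
  induction c using Quotient.inductionOn with | h φ => ?_
  let f : Equiv.Perm (Fin t) × Bool →
      {ψ : (coMatching t).Appearance G // Quotient.mk ((coMatching t).sameCopy G) ψ =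
        Quotient.mk _ φ} := fun x =>
    ⟨⟨(coMatchingAut x).toEmbedding.trans φ.1, fun u v h => φ.2.1 _ _
        (((isAutomorphism_coMatchingAut x).1 u v).2 h), fun u v h => φ.2.2 _ _
        (((isAutomorphism_coMatchingAut x).2 u v).2 h)⟩,
      (Quotient.sound ⟨coMatchingAut x, isAutomorphism_coMatchingAut x, fun _ => rfl⟩ :
        Quotient.mk ((coMatching t).sameCopy G) φ = _).symm⟩
  have hf : Function.Bijective f := by
    constructor
    · intro x y h
      apply coMatchingAut_injective ht
      ext1 s
      have := congrArg (fun ψ => ψ.1.1 s) h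
      exact φ.1.injective this
    · rintro ⟨ψ, hψ⟩
      obtain ⟨α, hα, h⟩ := Quotient.exact hψ.symm
      obtain ⟨x, rfl⟩ := exists_eq_coMatchingAut ht hα
      refine ⟨x, Subtype.ext (Subtype.ext ?_)⟩
      ext1 s
      exact (h s).symm
  rw [← Nat.card_congr (Equiv.ofBijective f hf), Nat.card_prod, Nat.card_perm]
  simp [mul_comm]

/-- The vertex `v` can take the place of any of the `2 * t` vertices of a co-matching, and by
symmetry each place contributes the same number. -/
theorem card_coMatchingPairs_erase [DecidableEq V] (G : SimpleGraph V) (t : ℕ) (A : Finset V)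
    (v : V) : (coMatchingPairs G (t + 1) A).card =
      (coMatchingPairs G (t + 1) (A.erase v)).card +
        2 * (t + 1) * ((coMatchingPairs G (t + 1) A).filter fun q => q.1 0 = v).card := by
  classical
  -- either `v` does not occur in `q`, or it stands in exactly one place `s`
  have h1 : ∀ q ∈ coMatchingPairs G (t + 1) A,
      (if q ∈ coMatchingPairs G (t + 1) (A.erase v) then 1 else 0) +
        ∑ s : Fin (t + 1) ⊕ Fin (t + 1), (if Sum.elim q.1 q.2 s = v then 1 else 0) = 1 := by
    intro q hq
    have hinj := sumElim_injective_of_mem_coMatchingPairs hq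
    by_cases hv : ∃ s, Sum.elim q.1 q.2 s = v
    · obtain ⟨s, rfl⟩ := hv
      rw [if_neg,
        Finset.sum_congr rfl fun s' _ => if_congr (hinj.eq_iff (a := s') (b := s)) rfl rfl]
      · simp
      · intro h
        obtain ⟨⟨h1, h2⟩, -⟩ := mem_coMatchingPairs.1 h
        rcases s with i | i
        · simpa using h1 i
        · simpa using h2 i
    · rw [Finset.sum_eq_zero fun s _ => if_neg fun h => hv ⟨s, h⟩, add_zero, if_pos]
      obtain ⟨⟨h1, h2⟩, h⟩ := mem_coMatchingPairs.1 hq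
      exact mem_coMatchingPairs.2 ⟨⟨fun i => Finset.mem_erase.2 ⟨fun h => hv ⟨.inl i, h⟩, h1 i⟩,
        fun i => Finset.mem_erase.2 ⟨fun h => hv ⟨.inr i, h⟩, h2 i⟩⟩, h⟩
  have h2 : (coMatchingPairs G (t + 1) A).filter (· ∈ coMatchingPairs G (t + 1) (A.erase v)) =
      coMatchingPairs G (t + 1) (A.erase v) := by
    ext q
    simp only [Finset.mem_filter, mem_coMatchingPairs, Finset.mem_erase]
    constructor
    · exact fun h => h.2
    · exact fun h => ⟨⟨⟨fun i => (h.1.1 i).2, fun i => (h.1.2 i).2⟩, h.2⟩, h⟩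
  -- a transposition of indices, together with an exchange of the sides if necessary, moves the
  -- place `s` to the first place of the first side
  have h3 : ∀ s : Fin (t + 1) ⊕ Fin (t + 1),
      ((coMatchingPairs G (t + 1) A).filter fun q => Sum.elim q.1 q.2 s = v).card =
        ((coMatchingPairs G (t + 1) A).filter fun q => q.1 0 = v).card := by
    rintro (i | i)
    · refine Finset.card_nbij' (fun q => (q.1 ∘ Equiv.swap 0 i, q.2 ∘ Equiv.swap 0 i))
        (fun q => (q.1 ∘ Equiv.swap 0 i, q.2 ∘ Equiv.swap 0 i)) ?_ ?_ ?_ ?_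
      · intro q hq
        simp only [Finset.coe_filter, mem_coMatchingPairs, Set.mem_ofPred_eq] at hq ⊢
        simpa [hq.1.2] using ⟨⟨fun _ => hq.1.1.1 _, fun _ => hq.1.1.2 _⟩, hq.2⟩
      · intro q hq
        simp only [Finset.coe_filter, mem_coMatchingPairs, Set.mem_ofPred_eq] at hq ⊢
        simpa [hq.1.2] using ⟨⟨fun _ => hq.1.1.1 _, fun _ => hq.1.1.2 _⟩, hq.2⟩
      · intro q _
        ext <;> simp
      · intro q _
        ext <;> simp
    · refine Finset.card_nbij' (fun q => (q.2 ∘ Equiv.swap 0 i, q.1 ∘ Equiv.swap 0 i))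
        (fun q => (q.2 ∘ Equiv.swap 0 i, q.1 ∘ Equiv.swap 0 i)) ?_ ?_ ?_ ?_
      · intro q hq
        simp only [Finset.coe_filter, mem_coMatchingPairs, Set.mem_ofPred_eq] at hq ⊢
        refine ⟨⟨⟨fun _ => hq.1.1.2 _, fun _ => hq.1.1.1 _⟩, fun j k => ?_, fun j =>
          (hq.1.2.2 _).symm⟩, by simpa using hq.2⟩
        simp [G.adj_comm, hq.1.2.1, eq_comm]
      · intro q hq
        simp only [Finset.coe_filter, mem_coMatchingPairs, Set.mem_ofPred_eq] at hq ⊢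
        refine ⟨⟨⟨fun _ => hq.1.1.2 _, fun _ => hq.1.1.1 _⟩, fun j k => ?_, fun j =>
          (hq.1.2.2 _).symm⟩, by simpa using hq.2⟩
        simp [G.adj_comm, hq.1.2.1, eq_comm]
      · intro q _
        ext <;> simp
      · intro q _
        ext <;> simp
  calc (coMatchingPairs G (t + 1) A).card
      = ∑ q ∈ coMatchingPairs G (t + 1) A,
        ((if q ∈ coMatchingPairs G (t + 1) (A.erase v) then 1 else 0) +
        ∑ s : Fin (t + 1) ⊕ Fin (t + 1), (if Sum.elim q.1 q.2 s = v then 1 else 0)) := by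
        rw [Finset.sum_congr rfl h1, Finset.card_eq_sum_ones]
    _ = _ := by
        rw [Finset.sum_add_distrib, ← Finset.card_filter, h2, Finset.sum_comm]
        simp only [← Finset.card_filter, h3]
        rw [Finset.sum_const, Finset.card_univ, Fintype.card_sum, Fintype.card_fin, smul_eq_mul]
        ring

/-- The number of co-matchings in which `v` is the first vertex of the first side. The partner
`p` of `v` and the other vertices `y` of the second side are chosen first; then the vertices of
the first side can be chosen independently of each other: whether `x` can stand opposite to `y j`
depends only on `p` and `y`. -/
theorem card_filter_coMatchingPairs [DecidableEq V] [DecidableRel G.Adj] {v : V} (hv : v ∈ A)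
    (m : ℕ) :
    ((coMatchingPairs G (m + 1) A).filter fun q => q.1 0 = v).card =
      ∑ y ∈ Fintype.piFinset fun _ : Fin m => (A.erase v).filter (G.Adj v),
        ∑ p ∈ (A.erase v).filter fun p => ¬ G.Adj v p,
          ∏ j, ((A.erase v).filter fun x =>
            G.Adj p x ∧ x ≠ y j ∧ ∀ k, G.Adj (y k) x ↔ k ≠ j).card := by
  simp only [← Fintype.card_piFinset, ← Finset.card_sigma]
  refine Finset.card_nbij' (fun q => ⟨Fin.tail q.2, q.2 0, Fin.tail q.1⟩)
    (fun z => (Fin.cons v z.2.2, Fin.cons z.2.1 z.1)) ?_ ?_ ?_ ?_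
  · rintro ⟨a, b⟩ hq
    simp only [Finset.coe_filter, mem_coMatchingPairs, Set.mem_ofPred_eq] at hq
    obtain ⟨⟨⟨ha, hb⟩, hadj, hne⟩, rfl⟩ := hq
    refine Finset.mem_sigma.2 ⟨Fintype.mem_piFinset.2 fun i => Finset.mem_filter.2
      ⟨Finset.mem_erase.2 ⟨?_, hb _⟩, (hadj _ _).2 (Fin.succ_ne_zero i).symm⟩,
      Finset.mem_sigma.2 ⟨Finset.mem_filter.2 ⟨Finset.mem_erase.2 ⟨(hne 0).symm, hb 0⟩,
        fun h => (hadj 0 0).1 h rfl⟩, Fintype.mem_piFinset.2 fun j => Finset.mem_filter.2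
      ⟨Finset.mem_erase.2 ⟨?_, ha _⟩, ((hadj _ _).2 (Fin.succ_ne_zero j)).symm, hne _,
        fun k => ?_⟩⟩⟩
    · exact (G.ne_of_adj ((hadj _ _).2 (Fin.succ_ne_zero i).symm)).symm
    · intro h
      have h1 : G.Adj (a 0) (b j.succ) := (hadj _ _).2 (Fin.succ_ne_zero j).symm
      rw [← h] at h1
      exact (hadj _ _).1 h1 rfl
    · change G.Adj (b k.succ) (a j.succ) ↔ _
      rw [G.adj_comm, hadj, ne_eq, Fin.succ_inj, eq_comm]
  · rintro ⟨y, p, x⟩ hz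
    simp only [Finset.coe_sigma, Set.mem_sigma_iff, Finset.mem_coe, Fintype.mem_piFinset,
      Finset.mem_filter, Finset.mem_erase] at hz
    obtain ⟨hy, ⟨hp, hvp⟩, hx⟩ := hz
    simp only [Finset.coe_filter, mem_coMatchingPairs, Set.mem_ofPred_eq, Fin.forall_fin_succ,
      Fin.cons_zero, Fin.cons_succ, and_true]
    refine ⟨⟨⟨hv, fun i => (hx i).1.2⟩, hp.2, fun i => (hy i).1.2⟩, ⟨⟨?_, fun i => ?_⟩, fun i =>
      ⟨?_, fun j => ?_⟩⟩, hp.1.symm, fun i => (hx i).2.2.1⟩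
    · simpa using hvp
    · simpa [(Fin.succ_ne_zero i).symm] using (hy i).2
    · simpa [Fin.succ_ne_zero i] using (hx i).2.1.symm
    · rw [G.adj_comm, (hx i).2.2.2 j]
      simp [eq_comm]
  · rintro ⟨a, b⟩ hq
    simp only [Finset.coe_filter, Set.mem_ofPred_eq] at hq
    obtain ⟨-, rfl⟩ := hq
    simp [Fin.cons_self_tail]
  · rintro ⟨y, p, x⟩ hz
    simp [Fin.tail_cons]

theorem coMatchingPairs_empty (G : SimpleGraph V) (ht : 1 ≤ t) :
    coMatchingPairs G t ∅ = ∅ := by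
  ext q
  simp only [mem_coMatchingPairs, Finset.notMem_empty, iff_false]
  exact fun h => h.1.1 ⟨0, ht⟩

theorem card_coMatchingPairs_le (G : SimpleGraph V) (t : ℕ) (A : Finset V) :
    (coMatchingPairs G t A).card ≤ Fintype.card V ^ (2 * t) := by
  classical
  refine (Finset.card_le_univ _).trans_eq ?_
  simp [two_mul, pow_add]

end

namespace WordRAM

/-! ### Arithmetic in the language -/

namespace Expr

/-! The arithmetic symbols, applied to expressions, denote the operations of the machine; they
are computed modulo `2 ^ w`, and subtraction is cut off at `0`. -/

instance : Add Expr := ⟨op .add⟩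
instance : Sub Expr := ⟨op .sub⟩
instance : Mul Expr := ⟨op .mul⟩
instance : Div Expr := ⟨op .div⟩

/-- The sum of the values of `e` for `i` from `0` up to (but excluding) `b`. -/
abbrev sum (i : ℕ) (b e : Expr) : Expr := fold .add 0 i b e

/-- The product of the values of `e` for `i` from `0` up to (but excluding) `b`. -/
abbrev prod (i : ℕ) (b e : Expr) : Expr := fold .mul 1 i b e

/-- The truth value of `e ≠ f`, as a number. -/
def ne (e f : Expr) : Expr := lit 1 - (lit 1 - ((e - f) + (f - e)))

/-- The truth value of `e = f`, as a number: one of the two cut-off differences is positive if the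
values differ. -/
def eq (e f : Expr) : Expr := lit 1 - ((e - f) + (f - e))

/-- The remainder of a division. -/
def mod (e f : Expr) : Expr := e - e / f * f

variable {w : ℕ} {mem ρ : ℕ → ℕ} {e f : Expr} {a b : ℕ}

theorem eval_lit (h : a < 2 ^ w) : (lit a).eval w mem ρ = a := Nat.mod_eq_of_lt h

theorem eval_add (he : e.eval w mem ρ = a) (hf : f.eval w mem ρ = b) (h : a + b < 2 ^ w) :
    (e + f).eval w mem ρ = a + b := by
  subst he hf
  exact Nat.mod_eq_of_lt h

theorem eval_sub (he : e.eval w mem ρ = a) (hf : f.eval w mem ρ = b) (h : a < 2 ^ w) :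
    (e - f).eval w mem ρ = a - b := by
  subst he hf
  exact Nat.mod_eq_of_lt (lt_of_le_of_lt (Nat.sub_le _ _) h)

theorem eval_mul (he : e.eval w mem ρ = a) (hf : f.eval w mem ρ = b) (h : a * b < 2 ^ w) :
    (e * f).eval w mem ρ = a * b := by
  subst he hf
  exact Nat.mod_eq_of_lt h

theorem eval_div (he : e.eval w mem ρ = a) (hf : f.eval w mem ρ = b) (h : a < 2 ^ w) :
    (e / f).eval w mem ρ = a / b := by
  subst he hf
  exact Nat.mod_eq_of_lt (lt_of_le_of_lt (Nat.div_le_self _ _) h)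

theorem eval_load (he : e.eval w mem ρ = a) (hm : mem a = b) (h : b < 2 ^ w) :
    (load e).eval w mem ρ = b := by
  subst he hm
  exact Nat.mod_eq_of_lt h

theorem eval_mod (he : e.eval w mem ρ = a) (hf : f.eval w mem ρ = b) (h : a < 2 ^ w) :
    (mod e f).eval w mem ρ = a % b := by
  have h' := Nat.div_mul_le_self a b
  rw [mod, eval_sub he (eval_mul (eval_div he hf h) hf (by omega)) h]
  have := Nat.div_add_mod' a b
  omega

/-- Negation of a truth value. -/
theorem eval_one_sub {p : Prop} [Decidable p] (hw : 1 < 2 ^ w)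
    (he : e.eval w mem ρ = if p then 1 else 0) :
    (lit 1 - e).eval w mem ρ = if p then 0 else 1 := by
  rw [eval_sub (eval_lit hw) he hw]
  split_ifs <;> rfl

theorem eval_eq (hw : 1 < 2 ^ w) (he : e.eval w mem ρ = a) (hf : f.eval w mem ρ = b)
    (ha : a < 2 ^ w) (hb : b < 2 ^ w) : (eq e f).eval w mem ρ = if a = b then 1 else 0 := by
  rw [eq, eval_sub (eval_lit hw) (eval_add (eval_sub he hf ha) (eval_sub hf he hb) (by omega)) hw]
  split_ifs <;> omega

theorem eval_ne (hw : 1 < 2 ^ w) (he : e.eval w mem ρ = a) (hf : f.eval w mem ρ = b)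
    (ha : a < 2 ^ w) (hb : b < 2 ^ w) : (ne e f).eval w mem ρ = if a = b then 0 else 1 :=
  eval_one_sub hw (eval_eq hw he hf ha hb)

/-- Conjunction of truth values. -/
theorem eval_mul_indicator {p q : Prop} [Decidable p] [Decidable q] (hw : 1 < 2 ^ w)
    (he : e.eval w mem ρ = if p then 1 else 0) (hf : f.eval w mem ρ = if q then 1 else 0) :
    (e * f).eval w mem ρ = if p ∧ q then 1 else 0 := by
  rw [eval_mul he hf]
  · split_ifs <;> simp_all
  · split_ifs <;> omega

/-- Sums are computed modulo `2 ^ w`, whether or not the partial sums are smaller than `2 ^ w`. -/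
theorem eval_sum_mod {i N : ℕ} {F : Fin N → ℕ} (hb : f.eval w mem ρ = N)
    (he : ∀ k : Fin N, e.eval w mem (Function.update ρ i k) ≡ F k [MOD 2 ^ w]) :
    (sum i f e).eval w mem ρ = (∑ k, F k) % 2 ^ w := by
  rw [sum, eval, hb]
  clear hb
  induction N with
  | zero => simp
  | succ N ih =>
    rw [Fin.sum_univ_castSucc]
    change (_ + _) % _ = _
    rw [ih fun k => he k.castSucc]
    exact (Nat.mod_modEq _ _).add (he (Fin.last N))

/-- Products are computed modulo `2 ^ w`, whether or not the partial products are smaller than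
`2 ^ w`. -/
theorem eval_prod_mod {i N : ℕ} {F : Fin N → ℕ} (hb : f.eval w mem ρ = N)
    (he : ∀ k : Fin N, e.eval w mem (Function.update ρ i k) ≡ F k [MOD 2 ^ w]) :
    (prod i f e).eval w mem ρ = (∏ k, F k) % 2 ^ w := by
  rw [prod, eval, hb]
  clear hb
  induction N with
  | zero => simp
  | succ N ih =>
    rw [Fin.prod_univ_castSucc]
    change (_ * _) % _ = _
    rw [ih fun k => he k.castSucc]
    exact (Nat.mod_modEq _ _).mul (he (Fin.last N))

theorem eval_sum {i N : ℕ} {F : Fin N → ℕ} (hb : f.eval w mem ρ = N)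
    (he : ∀ k : Fin N, e.eval w mem (Function.update ρ i k) = F k) (h : ∑ k, F k < 2 ^ w) :
    (sum i f e).eval w mem ρ = ∑ k, F k := by
  rw [eval_sum_mod hb fun k => by rw [he k], Nat.mod_eq_of_lt h]

theorem eval_prod {i N : ℕ} {F : Fin N → ℕ} (hb : f.eval w mem ρ = N)
    (he : ∀ k : Fin N, e.eval w mem (Function.update ρ i k) = F k) (h : ∏ k, F k < 2 ^ w) :
    (prod i f e).eval w mem ρ = ∏ k, F k := by
  rw [eval_prod_mod hb fun k => by rw [he k], Nat.mod_eq_of_lt h]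

theorem cost_fold_le {i N : ℕ} {o : BinOp} {T : Fin N → ℕ} (hb : f.eval w mem ρ = N)
    (hT : ∀ k : Fin N, e.cost w mem (Function.update ρ i k) ≤ T k) :
    (fold o a i f e).cost w mem ρ ≤ f.cost w mem ρ + 8 + ∑ k, (T k + 7) := by
  rw [cost, hb, Finset.sum_range]
  have : ∑ k : Fin N, (e.cost w mem (Function.update ρ i k) + 7) ≤ ∑ k, (T k + 7) :=
    Finset.sum_le_sum fun k _ => by have := hT k; omega
  omega

theorem cost_fold_le_mul {i N T : ℕ} {o : BinOp} (hb : f.eval w mem ρ = N)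
    (hT : ∀ k : Fin N, e.cost w mem (Function.update ρ i k) ≤ T) :
    (fold o a i f e).cost w mem ρ ≤ f.cost w mem ρ + 8 + N * (T + 7) :=
  (cost_fold_le hb hT).trans (by simp)

theorem cost_add : (e + f).cost w mem ρ = e.cost w mem ρ + f.cost w mem ρ + 1 := rfl
theorem cost_sub : (e - f).cost w mem ρ = e.cost w mem ρ + f.cost w mem ρ + 1 := rfl
theorem cost_mul : (e * f).cost w mem ρ = e.cost w mem ρ + f.cost w mem ρ + 1 := rfl
theorem cost_div : (e / f).cost w mem ρ = e.cost w mem ρ + f.cost w mem ρ + 1 := rfl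

end Expr

open WordRAM.Expr

/-! ### The input and the layout of the memory -/

/-! The variables of the program are used as follows.

* `0`: the sum computed so far, and the answer at the end;
* `1`, `2`, `3`: the numbers `m = t - 1` and `n`, and the first address after the input;
* `4`, `5`: the vertex `v` that is being removed, and the number `δ` of its remaining neighbours;
* `6`, `7`: the smallest key found so far, and the key of the current vertex;
* `9`, `10`: a vertex, and an index into an adjacency list;
* `11`, `12`, `13`, `14`: the code `c` of the tuple `y`, the partner `p` of `v`, and indices `j`
  and `k` of entries of `y`;
* `15`: the index of a product;
* `16`: the total length of the adjacency lists;
* `17`, `18`: the counter of the rounds, and that of the loop that serves as a conditional. -/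

/-- The `i`-th offset: the total length of the first `i` adjacency lists. -/
def offset {n : ℕ} (L : Fin n → List (Fin n)) (i : ℕ) : ℕ :=
  (((List.ofFn L).take i).map List.length).sum

/-- The first address after the input. From here on the memory holds a table with rows of
length `n`: row `0` marks the deleted vertices, row `1` lists neighbours of the current vertex, and
row `u + 2` is the row of the adjacency matrix that belongs to the vertex `u`. -/
def base {n : ℕ} (L : Fin n → List (Fin n)) : ℕ := n + 3 + offset L n

section offset

variable {n : ℕ} {L : Fin n → List (Fin n)}

theorem offset_succ (u : Fin n) : offset L (u + 1) = offset L u + (L u).length := by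
  unfold offset
  rw [List.take_add_one, List.map_append, List.sum_append]
  simp

theorem offset_mono {i j : ℕ} (hij : i ≤ j) : offset L i ≤ offset L j := by
  unfold offset
  obtain ⟨k, rfl⟩ := Nat.exists_eq_add_of_le hij
  rw [List.take_add, List.map_append, List.sum_append]
  omega

theorem offset_eq_sum (L : Fin n → List (Fin n)) : offset L n = ∑ u, (L u).length := by
  unfold offset
  rw [List.take_of_length_le (by simp), List.map_ofFn, List.sum_ofFn]
  rfl

theorem getElem?_flatten_offset (u : Fin n) {e : ℕ} (he : e < (L u).length) :
    (List.ofFn L).flatten[offset L u + e]? = some (L u)[e] := by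
  have h := List.drop_take_succ_flatten_eq_getElem (List.ofFn L) u (by simp)
  have h2 := congrArg (fun l => l[e]?) h
  simp only [List.getElem?_drop, List.getElem_ofFn] at h2
  rw [List.getElem?_take_of_lt] at h2
  · rw [offset, List.map_take, h2]
    simp [he]
  · have := offset_succ (L := L) u
    simp only [offset, List.map_take] at this ⊢
    omega

end offset

/-- The offsets and the neighbour lists of the input stand in the memory. -/
structure InputMem {n : ℕ} (L : Fin n → List (Fin n)) (mem : ℕ → ℕ) : Prop where
  offset : ∀ i ≤ n, mem (2 + i) = offset L i
  nbr : ∀ (u : Fin n) (e : ℕ) (h : e < (L u).length),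
    mem (n + 3 + WordRAM.offset L u + e) = (L u)[e]

theorem InputMem.update {n : ℕ} {L : Fin n → List (Fin n)} {mem : ℕ → ℕ} (h : InputMem L mem)
    {x a : ℕ} (hx : base L ≤ x) : InputMem L (Function.update mem x a) := by
  unfold base at hx
  refine ⟨fun i hi => ?_, fun u e he => ?_⟩
  · rw [Function.update_of_ne (by omega), h.offset i hi]
  · have h1 := offset_succ (L := L) u
    have h2 := offset_mono (L := L) (show (u : ℕ) + 1 ≤ n from u.2)
    rw [Function.update_of_ne (by omega), h.nbr u e he]

/-- The variables that stay fixed: `m` is one less than the size of the co-matching. -/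
structure Base {n : ℕ} (L : Fin n → List (Fin n)) (m : ℕ) (ρ : ℕ → ℕ) : Prop where
  m : ρ 1 = m
  n : ρ 2 = n
  base : ρ 3 = base L

theorem Base.update {n m : ℕ} {L : Fin n → List (Fin n)} {ρ : ℕ → ℕ} (h : Base L m ρ) {i a : ℕ}
    (hi : i = 0 ∨ 4 ≤ i) : Base L m (Function.update ρ i a) := by
  refine ⟨?_, ?_, ?_⟩
  · rw [Function.update_of_ne (by omega), h.m]
  · rw [Function.update_of_ne (by omega), h.n]
  · rw [Function.update_of_ne (by omega), h.base]

/-- The words are large enough for all addresses, for the parameter `m`, and for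
`n ^ (2 * (m + 1))`, which bounds the number of pairs of enumerated sides and the codes of
tuples. -/
structure Fits {n : ℕ} (w m : ℕ) (L : Fin n → List (Fin n)) : Prop where
  mem_lt : base L + (n + 2) * n < 2 ^ w
  m_lt : m < 2 ^ w
  pow_lt : n ^ (2 * (m + 1)) < 2 ^ w

/-- The degree of the vertex `u`. -/
def degE (u : Expr) : Expr := load (lit 3 + u) - load (lit 2 + u)

/-- The entry number `e` of the adjacency list of `u`. -/
def nbrE (u e : Expr) : Expr := load (var 2 + lit 3 + load (lit 2 + u) + e)

/-- `1` if `u` has been deleted, and `0` otherwise. -/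
def deadE (u : Expr) : Expr := load (var 3 + u)

/-- The entry number `i` of the row that lists neighbours of the current vertex. -/
def leftE (i : Expr) : Expr := load (var 3 + var 2 + i)

/-- The address of the entry of the adjacency matrix at `u` and `x`. -/
def cellE (u x : Expr) : Expr := var 3 + (u + lit 2) * var 2 + x

/-- `1` if `u` and `x` are adjacent, and `0` otherwise. -/
def adjE (u x : Expr) : Expr := load (cellE u x)

section values

variable {n w m : ℕ} {L : Fin n → List (Fin n)} {mem ρ : ℕ → ℕ} {e f : Expr}

theorem Fits.lt (hF : Fits w m L) : n + 3 + offset L n + (n + 2) * n < 2 ^ w := hF.mem_lt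

theorem Fits.one_lt (hF : Fits w m L) : 1 < 2 ^ w := by
  have := hF.lt
  omega

theorem cell_lt (u x : Fin n) : (u + 2) * n + x < (n + 2) * n := by
  have := u.2
  have := x.2
  nlinarith

/-- Different entries of the adjacency matrix have different addresses. -/
theorem cell_inj {u u' x x' : Fin n} :
    ((u : ℕ) + 2) * n + x = (u' + 2) * n + x' ↔ u = u' ∧ x = x' := by
  constructor
  · intro h
    have h1 : (((u : ℕ) + 2) * n + x) / n = u + 2 := by
      rw [mul_comm, Nat.mul_add_div (by have := u.2; omega), Nat.div_eq_of_lt x.2, add_zero]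
    have h2 : (((u' : ℕ) + 2) * n + x') / n = u' + 2 := by
      rw [mul_comm, Nat.mul_add_div (by have := u.2; omega), Nat.div_eq_of_lt x'.2, add_zero]
    have hu : u = u' := Fin.ext (by rw [h] at h1; omega)
    subst hu
    exact ⟨rfl, Fin.ext (by omega)⟩
  · rintro ⟨rfl, rfl⟩
    rfl

theorem eval_degE (hF : Fits w m L) (hI : InputMem L mem) {u : Fin n}
    (he : e.eval w mem ρ = u) : (degE e).eval w mem ρ = (L u).length := by
  have h1 := offset_succ (L := L) u
  have h2 := offset_mono (L := L) (show (u : ℕ) + 1 ≤ n from u.2)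
  have h3 := hF.lt
  have hu := u.2
  rw [degE, eval_sub
    (eval_load (eval_add (eval_lit (by omega)) he (by omega))
      (show mem (3 + u) = offset L (u + 1) by
        rw [← hI.offset (u + 1) u.2]
        congr 1
        omega) (by omega))
    (eval_load (eval_add (eval_lit (by omega)) he (by omega)) (hI.offset u u.2.le) (by omega))
    (by omega)]
  omega

theorem eval_nbrE (hF : Fits w m L) (hI : InputMem L mem) (hB : Base L m ρ) {u : Fin n} {k : ℕ}
    (he : e.eval w mem ρ = u) (hf : f.eval w mem ρ = k) (hk : k < (L u).length) :
    (nbrE e f).eval w mem ρ = (L u)[k] := by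
  have h1 := offset_succ (L := L) u
  have h2 := offset_mono (L := L) (show (u : ℕ) + 1 ≤ n from u.2)
  have h3 := hF.lt
  have hu := u.2
  have hx := ((L u)[k]).2
  exact eval_load (eval_add (eval_add (eval_add (show eval w mem (var 2) ρ = n from hB.n)
    (eval_lit (by omega)) (by omega)) (eval_load (eval_add (eval_lit (by omega)) he (by omega))
    (hI.offset u u.2.le) (by omega)) (by omega)) hf (by omega)) (hI.nbr u k hk) (by omega)

theorem eval_deadE (hF : Fits w m L) (hB : Base L m ρ) {u : Fin n} (he : e.eval w mem ρ = u)
    {a : ℕ} (ha : mem (base L + u) = a) (hlt : a < 2 ^ w) : (deadE e).eval w mem ρ = a := by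
  have h3 := hF.lt
  have hu := u.2
  refine eval_load (eval_add (show eval w mem (var 3) ρ = base L from hB.base) he ?_) ha hlt
  unfold base
  nlinarith

theorem eval_leftE (hF : Fits w m L) (hB : Base L m ρ) {u : Fin n} (he : e.eval w mem ρ = u)
    {x : Fin n} (ha : mem (base L + n + u) = x) : (leftE e).eval w mem ρ = x := by
  have h3 := hF.mem_lt
  have hu := u.2
  have hx := x.2
  have : base L + n + u < 2 ^ w := by nlinarith
  exact eval_load (eval_add (eval_add (show eval w mem (var 3) ρ = base L from hB.base)
    (show eval w mem (var 2) ρ = n from hB.n) (by omega)) he (by omega)) ha (by omega)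

theorem eval_cellE (hF : Fits w m L) (hB : Base L m ρ) {u x : Fin n} (he : e.eval w mem ρ = u)
    (hf : f.eval w mem ρ = x) : (cellE e f).eval w mem ρ = base L + (u + 2) * n + x := by
  have h3 := hF.mem_lt
  have h4 := cell_lt u x
  have hu := u.2
  have : n + 2 ≤ (n + 2) * n := by nlinarith
  exact eval_add (eval_add (show eval w mem (var 3) ρ = base L from hB.base)
    (eval_mul (eval_add he (eval_lit (by omega)) (by omega))
      (show eval w mem (var 2) ρ = n from hB.n) (by omega)) (by omega)) hf (by omega)

theorem eval_adjE (hF : Fits w m L) (hB : Base L m ρ) {u x : Fin n} (he : e.eval w mem ρ = u)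
    (hf : f.eval w mem ρ = x) {a : ℕ} (ha : mem (base L + (u + 2) * n + x) = a)
    (hlt : a < 2 ^ w) : (adjE e f).eval w mem ρ = a :=
  eval_load (eval_cellE hF hB he hf) ha hlt

end values

/-! ### The contribution of one vertex -/

/-- The neighbour `x` of `p` that stands in its adjacency list at the position `var 10`. -/
def xE : Expr := nbrE (var 12) (var 10)

/-- The `k`-th power of the number of listed neighbours of `v`. -/
def powE (k : Expr) : Expr := prod 15 k (var 5)

/-- The vertex `y k`: the digits of the number `var 11` to the base `var 5` encode a tuple of
listed neighbours. -/
def yE (k : Expr) : Expr := leftE (mod (var 11 / powE k) (var 5))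

/-- Whether the indices `k` such that `x` is adjacent to `y k` are exactly those other than
`var 13`. -/
def testE : Expr := prod 14 (var 1) (eq (adjE (yE (var 14)) xE) (ne (var 14) (var 13)))

/-- The number of remaining vertices that can be the partner of the vertex `y j` with `j` in
`var 13`. It suffices to search the adjacency list of `p`. -/
def countE : Expr :=
  sum 10 (degE (var 12)) ((lit 1 - deadE xE) * (ne xE (yE (var 13)) * testE))

/-- The number of ways to complete the vertices chosen so far if `p` is the partner of `v`. -/
def pairE : Expr :=
  (lit 1 - deadE (var 12)) * (lit 1 - adjE (var 4) (var 12)) * prod 13 (var 1) countE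

/-- The number of co-matchings with enumerated sides that have `v` as the first vertex of the
first side: the formula of `card_filter_coMatchingPairs`, with a sum over codes in place of the sum
over the tuples `y`. -/
def coreE : Expr := sum 11 (powE (var 1)) (sum 12 (var 2) pairE)

open Classical in
/-- The memory holds the input, the set `A` of the vertices that have not been deleted, and the
adjacency matrix. -/
structure MemOK {n : ℕ} (G : SimpleGraph (Fin n)) (L : Fin n → List (Fin n)) (A : Finset (Fin n))
    (mem : ℕ → ℕ) : Prop where
  input : InputMem L mem
  dead : ∀ u : Fin n, mem (base L + u) = if u ∈ A then 0 else 1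
  adj : ∀ u x : Fin n, mem (base L + (u + 2) * n + x) = if G.Adj u x then 1 else 0

section core

open Classical

variable {n w m : ℕ} {G : SimpleGraph (Fin n)} {L : Fin n → List (Fin n)} {A : Finset (Fin n)}
  {mem ρ : ℕ → ℕ} {e f : Expr}

theorem eval_one_sub_deadE (hF : Fits w m L) (hM : MemOK G L A mem) (hB : Base L m ρ) {u : Fin n}
    (he : e.eval w mem ρ = u) :
    (lit 1 - deadE e).eval w mem ρ = if u ∈ A then 1 else 0 := by
  have h1 := hF.one_lt
  rw [eval_sub (eval_lit h1) (eval_deadE hF hB he (hM.dead u) (by split_ifs <;> omega)) h1]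
  split_ifs <;> rfl

theorem eval_adjE_indicator (hF : Fits w m L) (hM : MemOK G L A mem) (hB : Base L m ρ)
    {u x : Fin n} (he : e.eval w mem ρ = u) (hf : f.eval w mem ρ = x) :
    (adjE e f).eval w mem ρ = if G.Adj u x then 1 else 0 :=
  eval_adjE hF hB he hf (hM.adj u x) (by have := hF.one_lt; split_ifs <;> omega)

variable {δ c : ℕ} {y : Fin m → Fin n}

theorem eval_powE {k : ℕ} (he : e.eval w mem ρ = k) (h5 : ρ 5 = δ) (h : δ ^ k < 2 ^ w) :
    (powE e).eval w mem ρ = δ ^ k := by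
  rw [powE, eval_prod (F := fun _ => δ) he fun k => ?_]
  · simp
  · simpa using h
  · change Function.update ρ 15 _ 5 = δ
    rw [Function.update_of_ne (by omega), h5]

theorem Fits.pow_lt_of_le (hF : Fits w m L) (hn : 0 < n) (hδ : δ ≤ n) {k : ℕ} (hk : k ≤ m) :
    δ ^ k < 2 ^ w :=
  ((Nat.pow_le_pow_left hδ k).trans (Nat.pow_le_pow_right hn (by omega))).trans_lt hF.pow_lt

/-- The variables that determine the tuple `y`: the number of listed neighbours and the code. -/
structure LeftVars (δ c : ℕ) (ρ : ℕ → ℕ) : Prop where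
  h5 : ρ 5 = δ
  h11 : ρ 11 = c

theorem LeftVars.update (h : LeftVars δ c ρ) {i a : ℕ} (hi : 12 ≤ i ∨ i = 10) :
    LeftVars δ c (Function.update ρ i a) := by
  refine ⟨?_, ?_⟩
  · rw [Function.update_of_ne (by omega), h.h5]
  · rw [Function.update_of_ne (by omega), h.h11]

theorem eval_yE (hF : Fits w m L) (hB : Base L m ρ) (hV : LeftVars δ c ρ) (hδ : δ ≤ n)
    (hc : c < δ ^ m) (hy : ∀ k : Fin m, mem (base L + n + (c / δ ^ (k : ℕ) % δ)) = y k)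
    {k : Fin m} (he : e.eval w mem ρ = k) : (yE e).eval w mem ρ = y k := by
  have hδ0 : 0 < δ := by
    rcases Nat.eq_zero_or_pos δ with rfl | h
    · rw [zero_pow (by have := k.2; omega)] at hc
      omega
    · exact h
  have hcw : c < 2 ^ w := hc.trans (hF.pow_lt_of_le (by omega) hδ le_rfl)
  have hlt : c / δ ^ (k : ℕ) % δ < n := (Nat.mod_lt _ hδ0).trans_le hδ
  refine eval_leftE hF hB (u := ⟨_, hlt⟩) ?_ (hy k)
  exact eval_mod (eval_div (show eval w mem (var 11) ρ = c from hV.h11)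
    (eval_powE he hV.h5 (hF.pow_lt_of_le (by omega) hδ k.2.le)) hcw)
    (show eval w mem (var 5) ρ = δ from hV.h5) (lt_of_le_of_lt (Nat.div_le_self _ _) hcw)

theorem eval_testE (hF : Fits w m L) (hM : MemOK G L A mem) (hB : Base L m ρ)
    (hV : LeftVars δ c ρ) (hδ : δ ≤ n) (hc : c < δ ^ m)
    (hy : ∀ k : Fin m, mem (base L + n + (c / δ ^ (k : ℕ) % δ)) = y k) {p : Fin n} {e : ℕ}
    (he : e < (L p).length) {j : Fin m} (h12 : ρ 12 = p) (h10 : ρ 10 = e) (h13 : ρ 13 = j) :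
    testE.eval w mem ρ = if ∀ k, G.Adj (y k) (L p)[e] ↔ k ≠ j then 1 else 0 := by
  have h1 := hF.one_lt
  rw [testE, eval_prod (F := fun k : Fin m => if G.Adj (y k) (L p)[e] ↔ k ≠ j then 1 else 0)
    (show eval w mem (var 1) ρ = m from hB.m)]
  · simp [Finset.prod_boole]
  · intro k
    have hB' := hB.update (i := 14) (a := k) (by omega)
    have hV' := hV.update (i := 14) (a := k) (by omega)
    have h14 : eval w mem (var 14) (Function.update ρ 14 (k : ℕ)) = k := by
      simp [eval]
    have h13' : eval w mem (var 13) (Function.update ρ 14 (k : ℕ)) = j := by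
      simp [eval, h13]
    have hx : xE.eval w mem (Function.update ρ 14 (k : ℕ)) = (L p)[e] :=
      eval_nbrE hF hM.input hB' (u := p) (e := var 12) (f := var 10) (k := e)
      (by simp [eval, h12]) (by simp [eval, h10]) he
    have hm := hF.m_lt
    have hk := k.2
    have hj := j.2
    rw [eval_eq h1 (eval_adjE_indicator hF hM hB' (eval_yE hF hB' hV' hδ hc hy h14) hx)
      (eval_ne h1 h14 h13' (by omega) (by omega)) (by split_ifs <;> omega)
      (by split_ifs <;> omega)]
    simp only [← Fin.ext_iff]
    by_cases h : k = j <;> by_cases h' : G.Adj (y k) (L p)[e] <;> simp [h, h']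
  · simp only [Finset.prod_boole]
    split_ifs <;> omega

/-- A sum over the entries of an adjacency list is a sum over the neighbours. -/
theorem sum_getElem_adjacencyList (hL : IsAdjacencyList G L) (p : Fin n) (f : Fin n → ℕ) :
    ∑ e : Fin (L p).length, f (L p)[e] = ∑ x with G.Adj p x, f x := by
  refine (Fin.sum_univ_fun_getElem (L p) f).trans ?_
  rw [← List.sum_toFinset _ (hL p).1]
  congr 1
  ext x
  simp [(hL p).2]

theorem eval_countE (hF : Fits w m L) (hL : IsAdjacencyList G L) (hM : MemOK G L A mem)
    (hB : Base L m ρ) (hV : LeftVars δ c ρ) (hδ : δ ≤ n) (hc : c < δ ^ m)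
    (hy : ∀ k : Fin m, mem (base L + n + (c / δ ^ (k : ℕ) % δ)) = y k) {p : Fin n} {j : Fin m}
    (h12 : ρ 12 = p) (h13 : ρ 13 = j) :
    countE.eval w mem ρ =
      (A.filter fun x => G.Adj p x ∧ x ≠ y j ∧ ∀ k, G.Adj (y k) x ↔ k ≠ j).card := by
  have h1 := hF.one_lt
  have hlt := hF.lt
  have hsum : ∑ e : Fin (L p).length,
      (if (L p)[e] ∈ A ∧ (L p)[e] ≠ y j ∧ ∀ k, G.Adj (y k) (L p)[e] ↔ k ≠ j then 1 else 0) =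
      (A.filter fun x => G.Adj p x ∧ x ≠ y j ∧ ∀ k, G.Adj (y k) x ↔ k ≠ j).card := by
    rw [sum_getElem_adjacencyList hL p
      fun x => if x ∈ A ∧ x ≠ y j ∧ ∀ k, G.Adj (y k) x ↔ k ≠ j then 1 else 0,
      ← Finset.card_filter, Finset.filter_filter]
    congr 1
    ext x
    simp only [Finset.mem_filter, Finset.mem_univ, true_and]
    tauto
  rw [countE, eval_sum (F := fun e : Fin (L p).length =>
    if (L p)[e] ∈ A ∧ (L p)[e] ≠ y j ∧ ∀ k, G.Adj (y k) (L p)[e] ↔ k ≠ j then 1 else 0)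
    (eval_degE hF hM.input (e := var 12) h12), hsum]
  · intro e
    have hB' := hB.update (i := 10) (a := e) (by omega)
    have hV' := hV.update (i := 10) (a := e) (by omega)
    have hx : xE.eval w mem (Function.update ρ 10 (e : ℕ)) = (L p)[e] :=
      eval_nbrE hF hM.input hB' (u := p) (e := var 12) (f := var 10) (k := e)
      (by simp [eval, h12]) (by simp [eval]) e.2
    have hxlt := ((L p)[e]).2
    have hylt := (y j).2
    refine eval_mul_indicator h1 (eval_one_sub_deadE hF hM hB' hx) (eval_mul_indicator h1 ?_
      (eval_testE hF hM hB' hV' hδ hc hy e.2 (by simp [h12]) (by simp) (by simp [h13])))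
    rw [eval_ne h1 hx (eval_yE hF hB' hV' hδ hc hy (e := var 13) (k := j) (by simp [eval, h13]))
      (by omega) (by omega)]
    simp only [← Fin.ext_iff, ne_eq, ite_not]
  · rw [hsum]
    have := Finset.card_le_univ
      (A.filter fun x => G.Adj p x ∧ x ≠ y j ∧ ∀ k, G.Adj (y k) x ↔ k ≠ j)
    rw [Fintype.card_fin] at this
    omega

theorem eval_pairE (hF : Fits w m L) (hL : IsAdjacencyList G L) (hM : MemOK G L A mem)
    (hB : Base L m ρ) (hV : LeftVars δ c ρ) (hδ : δ ≤ n) (hc : c < δ ^ m)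
    (hy : ∀ k : Fin m, mem (base L + n + (c / δ ^ (k : ℕ) % δ)) = y k) {v p : Fin n}
    (h4 : ρ 4 = v) (h12 : ρ 12 = p) :
    pairE.eval w mem ρ ≡ (if p ∈ A ∧ ¬ G.Adj v p then
      ∏ j, (A.filter fun x => G.Adj p x ∧ x ≠ y j ∧ ∀ k, G.Adj (y k) x ↔ k ≠ j).card else 0)
      [MOD 2 ^ w] := by
  have h1 := hF.one_lt
  have hprod : (prod 13 (var 1) countE).eval w mem ρ =
      (∏ j, (A.filter fun x => G.Adj p x ∧ x ≠ y j ∧ ∀ k, G.Adj (y k) x ↔ k ≠ j).card) % 2 ^ w := by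
    refine eval_prod_mod hB.m fun j => ?_
    rw [eval_countE hF hL hM (hB.update (by omega)) (hV.update (by omega)) hδ hc hy (p := p)
      (j := j) (by simp [h12]) (by simp)]
  have hadj : (lit 1 - adjE (var 4) (var 12)).eval w mem ρ =
      if ¬ G.Adj v p then 1 else 0 := by
    rw [eval_one_sub h1 (eval_adjE_indicator hF hM hB (e := var 4) (f := var 12) h4 h12),
      ite_not]
  change (_ * _) % _ ≡ _ [MOD _]
  rw [eval_mul_indicator h1 (eval_one_sub_deadE hF hM hB (e := var 12) h12) hadj, hprod]
  refine (Nat.mod_modEq _ _).trans ?_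
  split_ifs
  · simpa using Nat.mod_modEq _ _
  · simp [Nat.ModEq.refl]

/-- The numbers below `δ ^ m` encode the tuples of listed neighbours by their digits. -/
theorem sum_digits {F : List (Fin n)} (hF : F.Nodup) (h : (Fin m → Fin n) → ℕ) :
    ∑ c : Fin (F.length ^ m), h (fun k => F[finFunctionFinEquiv.symm c k]) =
      ∑ y ∈ Fintype.piFinset fun _ : Fin m => F.toFinset, h y := by
  rw [← Equiv.sum_comp finFunctionFinEquiv]
  simp only [Equiv.symm_apply_apply]
  refine Finset.sum_bij (fun g _ k => F[g k]) ?_ ?_ ?_ ?_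
  · intro g _
    simp [Fintype.mem_piFinset]
  · intro g _ g' _ hg
    funext k
    exact Fin.ext ((List.Nodup.getElem_inj_iff hF).1 (congrFun hg k))
  · intro y hy
    have : ∀ k, ∃ i : Fin F.length, F[i] = y k := by
      intro k
      obtain ⟨i, hi, h⟩ := List.getElem_of_mem (List.mem_toFinset.1 (Fintype.mem_piFinset.1 hy k))
      exact ⟨⟨i, hi⟩, h⟩
    choose g hg using this
    exact ⟨g, Finset.mem_univ _, funext hg⟩
  · intro g _
    rfl

/-- The value of `coreE` after `v` has been deleted and its remaining neighbours `F` have been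
listed. -/
theorem eval_coreE (hF : Fits w m L) (hL : IsAdjacencyList G L) {v : Fin n} (hv : v ∈ A)
    (hM : MemOK G L (A.erase v) mem) (hB : Base L m ρ) {F : List (Fin n)} (hnd : F.Nodup)
    (hF' : F.toFinset = (A.erase v).filter (G.Adj v)) (h5 : ρ 5 = F.length)
    (hrow : ∀ i (h : i < F.length), mem (base L + n + i) = F[i]) (h4 : ρ 4 = v) :
    coreE.eval w mem ρ =
      ((coMatchingPairs G (m + 1) A).filter fun q => q.1 0 = v).card % 2 ^ w := by
  have hδ : F.length ≤ n := by
    simpa using hnd.length_le_card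
  rw [card_filter_coMatchingPairs hv, ← hF', ← sum_digits hnd, coreE,
    eval_sum_mod (eval_powE (e := var 1) hB.m h5
      (hF.pow_lt_of_le (by have := v.2; omega) hδ le_rfl))]
  intro c
  have hB' := hB.update (i := 11) (a := c) (by omega)
  rw [eval_sum_mod (ρ := Function.update ρ 11 (c : ℕ)) (f := var 2) hB'.n
    (F := fun p : Fin n => if p ∈ A.erase v ∧ ¬ G.Adj v p then
      ∏ j, ((A.erase v).filter fun x => G.Adj p x ∧ x ≠ F[finFunctionFinEquiv.symm c j] ∧
        ∀ k, G.Adj (F[finFunctionFinEquiv.symm c k]) x ↔ k ≠ j).card else 0)]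
  · refine (Nat.mod_modEq _ _).trans ?_
    rw [Finset.sum_ite, Finset.sum_const_zero, add_zero, ← Finset.filter_filter]
    simp only [Finset.filter_univ_mem]
    rfl
  · intro p
    refine eval_pairE hF hL hM (hB'.update (by omega)) (δ := F.length) (c := c)
      ⟨by simp [h5], by simp⟩ hδ c.2
      (y := fun k => F[finFunctionFinEquiv.symm c k]) ?_ (by simp [h4]) (by simp)
    intro k
    exact hrow _ (finFunctionFinEquiv.symm c k).2

end core

/-! ### Costs of the expressions -/

section cost

open Classical

variable {n w m : ℕ} {L : Fin n → List (Fin n)} {mem ρ : ℕ → ℕ} {e f : Expr}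

theorem cost_var (i : ℕ) : (var i).cost w mem ρ = 2 := rfl
theorem cost_lit (a : ℕ) : (lit a).cost w mem ρ = 1 := rfl
theorem cost_load : (load e).cost w mem ρ = e.cost w mem ρ + 1 := rfl

theorem cost_xE : xE.cost w mem ρ = 14 := rfl

theorem cost_degE (i : ℕ) : (degE (var i)).cost w mem ρ = 11 := rfl

theorem cost_yE_le {i k : ℕ} (h : ρ i = k) (hk : k ≤ m) :
    (yE (var i)).cost w mem ρ ≤ 18 * m + 40 := by
  have hP : (powE (var i)).cost w mem ρ ≤ 9 * m + 10 := by
    have := cost_fold_le_mul (w := w) (mem := mem) (ρ := ρ) (a := 1) (i := 15) (N := k) (o := .mul)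
      (f := var i) (e := var 5) (T := 2) h (fun _ => le_rfl)
    rw [cost_var] at this
    exact this.trans (by omega)
  simp only [yE, leftE, mod, cost_load, cost_add, cost_sub, cost_mul, cost_div, cost_var]
  omega

theorem cost_testE_le (h1 : ρ 1 = m) : testE.cost w mem ρ ≤ 250 * (m + 1) ^ 2 := by
  have := cost_fold_le_mul (w := w) (mem := mem) (ρ := ρ) (a := 1) (i := 14) (N := m) (o := .mul)
      (f := var 1) (e := eq (adjE (yE (var 14)) xE) (ne (var 14) (var 13)))
      (T := 36 * m + 200) h1 (fun k => by
    have := cost_yE_le (w := w) (mem := mem) (ρ := Function.update ρ 14 k) (m := m) (i := 14)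
      (k := k) (by simp) k.2.le
    simp only [eq, Expr.ne, adjE, cellE, cost_load, cost_add, cost_sub, cost_mul, cost_var,
      cost_lit, cost_xE]
    omega)
  rw [cost_var] at this
  exact this.trans (by nlinarith)

theorem cost_countE_le (hF : Fits w m L) (hI : InputMem L mem) (h1 : ρ 1 = m) {p : Fin n}
    {j : Fin m} (h12 : ρ 12 = p) (h13 : ρ 13 = j) :
    countE.cost w mem ρ ≤ 19 + (L p).length * (407 * (m + 1) ^ 2) := by
  have := cost_fold_le_mul (w := w) (mem := mem) (ρ := ρ) (a := 0) (i := 10) (N := (L p).length)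
      (o := .add) (f := degE (var 12))
      (e := (lit 1 - deadE xE) * (Expr.ne xE (yE (var 13)) * testE))
      (T := 400 * (m + 1) ^ 2) (eval_degE hF hI (e := var 12) h12) (fun k => by
    have h := cost_yE_le (w := w) (mem := mem) (ρ := Function.update ρ 10 k) (m := m) (i := 13)
      (k := j) (by simp [h13]) j.2.le
    have h' := cost_testE_le (w := w) (mem := mem) (ρ := Function.update ρ 10 k) (m := m)
      (by simp [h1])
    simp only [Expr.ne, deadE, cost_load, cost_add, cost_sub, cost_mul, cost_var,
      cost_lit, cost_xE]
    nlinarith)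
  rw [cost_degE] at this
  refine this.trans (Nat.add_le_add_left (Nat.mul_le_mul_left _ ?_) _)
  nlinarith

theorem cost_pairE_le (hF : Fits w m L) (hI : InputMem L mem) (h1 : ρ 1 = m) {p : Fin n}
    (h12 : ρ 12 = p) :
    pairE.cost w mem ρ ≤ 100 * (m + 1) + (L p).length * (407 * (m + 1) ^ 3) := by
  have := cost_fold_le_mul (w := w) (mem := mem) (ρ := ρ) (a := 1) (i := 13) (N := m)
      (o := .mul) (f := var 1) (e := countE) (T := 19 + (L p).length * (407 * (m + 1) ^ 2)) h1
      (fun k => cost_countE_le hF hI (by simp [h1]) (by simp [h12]) (j := k) (by simp))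
  rw [cost_var] at this
  simp only [pairE, prod, adjE, cellE, deadE, cost_load, cost_add, cost_sub, cost_mul, cost_var,
    cost_lit]
  have h2 : m * ((L p).length * (407 * (m + 1) ^ 2)) ≤ (L p).length * (407 * (m + 1) ^ 3) := by
    rw [pow_succ _ 2]
    nlinarith [Nat.zero_le ((L p).length * (407 * (m + 1) ^ 2))]
  rw [Nat.mul_add, Nat.mul_add] at this
  omega

/-- For each of the `δ ^ m` tuples, the adjacency lists of all vertices `p` are searched once for
each `j`, and each test takes time of the order `(m + 1) ^ 2`, since the powers of `δ` are computed
anew. -/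
theorem cost_coreE_le (hF : Fits w m L) (hI : InputMem L mem) (hB : Base L m ρ) {δ : ℕ}
    (h5 : ρ 5 = δ) (hδ : δ ≤ n) (hn : 0 < n) :
    coreE.cost w mem ρ ≤ (27 + δ ^ m * (17 + 107 * n + 407 * offset L n)) * (m + 1) ^ 3 := by
  have hm1 : m + 1 ≤ (m + 1) ^ 3 := Nat.le_self_pow (by omega) _
  have hP : (powE (var 1)).cost w mem ρ ≤ 9 * m + 10 := by
    have := cost_fold_le_mul (w := w) (mem := mem) (ρ := ρ) (a := 1) (i := 15) (N := m) (o := .mul)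
      (f := var 1) (e := var 5) (T := 2) hB.m (fun _ => le_rfl)
    rw [cost_var] at this
    exact this.trans (by omega)
  have hS : ∀ c : Fin (δ ^ m), (sum 12 (var 2) pairE).cost w mem (Function.update ρ 11 c) ≤
      (10 + 107 * n + 407 * offset L n) * (m + 1) ^ 3 := by
    intro c
    have hB' := hB.update (i := 11) (a := c) (by omega)
    have := cost_fold_le (w := w) (mem := mem) (ρ := Function.update ρ 11 c) (a := 0) (i := 12)
      (N := n) (o := .add) (f := var 2) (e := pairE)
      (T := fun p => 100 * (m + 1) + (L p).length * (407 * (m + 1) ^ 3)) hB'.n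
      (fun p => cost_pairE_le hF hI (hB'.update (by omega)).m (by simp))
    have h' : ∑ p, (L p).length * (407 * (m + 1) ^ 3) =
        offset L n * (407 * (m + 1) ^ 3) := by
      rw [offset_eq_sum, Finset.sum_mul]
    simp only [cost_var, Finset.sum_add_distrib, h', Finset.sum_const, Finset.card_univ,
      Fintype.card_fin, smul_eq_mul] at this
    refine this.trans ?_
    nlinarith [Nat.mul_le_mul_left n hm1]
  have := cost_fold_le_mul (w := w) (mem := mem) (ρ := ρ) (a := 0) (i := 11) (o := .add)
    (eval_powE (e := var 1) hB.m h5 (hF.pow_lt_of_le hn hδ le_rfl)) hS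
  refine this.trans ?_
  have h7 : δ ^ m * 7 ≤ δ ^ m * (7 * (m + 1) ^ 3) := Nat.mul_le_mul_left _ (by omega)
  have h18 : 9 * m + 18 ≤ 27 * (m + 1) ^ 3 := by omega
  nlinarith

end cost

/-! ### Removal of a vertex of minimum degree -/

/-- The degree of the vertex in `var 9` in the remaining graph, increased by the number of all
vertices if this vertex has been deleted. -/
def keyE : Expr :=
  sum 10 (degE (var 9)) (lit 1 - deadE (nbrE (var 9) (var 10))) + deadE (var 9) * var 2

/-- Replaces the minimum `var 6`, which is attained at `var 4`, if the vertex in `var 9` has a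
smaller key. The cut-off differences replace a case distinction: the factor is the truth value of
`var 7 < var 6`, and the last value is the minimum of `var 6` and `var 7`. The search runs through
the vertices in increasing order, hence `var 4 ≤ var 9`, and the difference of these two is
exact. -/
def minBody : Cmd :=
  .seq (.assign 7 keyE) (.seq
    (.assign 4 (var 4 + (lit 1 - (lit 1 - (var 6 - var 7))) * (var 9 - var 4)))
    (.assign 6 (var 6 - (var 6 - var 7))))

/-- Puts a remaining vertex of minimum degree into `var 4`. -/
def minCmd : Cmd :=
  .seq (.assign 4 (lit 0)) (.seq (.assign 6 (var 2)) (.loop 9 (var 2) minBody))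

/-- Appends the neighbour with number `var 10` of the vertex `var 4` to the list of remaining
neighbours. The neighbour is written in any case, but if it has been deleted, then the length
`var 5` of the list is not increased. -/
def leftBody : Cmd :=
  .seq (.write (var 3 + var 2 + var 5) (nbrE (var 4) (var 10)))
    (.assign 5 (var 5 + (lit 1 - deadE (nbrE (var 4) (var 10)))))

/-- Removes a vertex of minimum degree and adds to `var 0` the number of co-matchings with
enumerated sides that have it as the first vertex of the first side. -/
def roundCmd : Cmd :=
  .seq minCmd (.seq (.write (var 3 + var 4) (lit 1)) (.seq (.assign 5 (lit 0)) (.seq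
    (.loop 10 (degE (var 4)) leftBody) (.assign 0 (var 0 + coreE)))))

open Classical in
/-- The value of `keyE` for the vertex `u` if the remaining vertices are those in `A`. -/
noncomputable def key {n : ℕ} (G : SimpleGraph (Fin n)) (A : Finset (Fin n)) (u : Fin n) : ℕ :=
  (A.filter (G.Adj u)).card + if u ∈ A then 0 else n

section

open Classical

variable {n w m : ℕ} {G : SimpleGraph (Fin n)} {L : Fin n → List (Fin n)} {A : Finset (Fin n)}
  {mem ρ : ℕ → ℕ} {s : Store}

theorem MemOK.update_row (hM : MemOK G L A mem) {i : ℕ} (hi : i < n) (a : ℕ) :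
    MemOK G L A (Function.update mem (base L + n + i) a) := by
  refine ⟨hM.input.update (by omega), fun u => ?_, fun u x => ?_⟩
  · rw [Function.update_of_ne (by omega), hM.dead]
  · rw [Function.update_of_ne _, hM.adj]
    rw [add_mul]
    have : 0 ≤ (u : ℕ) * n := Nat.zero_le _
    omega

theorem MemOK.delete (hM : MemOK G L A mem) (v : Fin n) :
    MemOK G L (A.erase v) (Function.update mem (base L + v) 1) := by
  refine ⟨hM.input.update (by omega), fun u => ?_, fun u x => ?_⟩
  · by_cases h : u = v
    · subst h
      simp
    · rw [Function.update_of_ne (by have := Fin.val_ne_of_ne h; omega), hM.dead]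
      simp [h]
  · rw [Function.update_of_ne _, hM.adj]
    rw [add_mul]
    have : 0 ≤ (u : ℕ) * n := Nat.zero_le _
    omega

theorem length_adjacencyList_le (hL : IsAdjacencyList G L) (u : Fin n) : (L u).length ≤ n := by
  simpa using (hL u).1.length_le_card

theorem eval_keyE (hF : Fits w m L) (hL : IsAdjacencyList G L) (hM : MemOK G L A mem)
    (hB : Base L m ρ) {u : Fin n} (h9 : ρ 9 = u) : keyE.eval w mem ρ = key G A u := by
  have h1 := hF.one_lt
  have hlt := hF.lt
  have hn : n ≤ (n + 2) * n := Nat.le_mul_of_pos_left _ (by omega)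
  have hcard := Finset.card_le_univ (A.filter (G.Adj u))
  rw [Fintype.card_fin] at hcard
  have hsum : ∑ e : Fin (L u).length, (if (L u)[e] ∈ A then 1 else 0) =
      (A.filter (G.Adj u)).card := by
    rw [sum_getElem_adjacencyList hL u fun x => if x ∈ A then 1 else 0,
      ← Finset.card_filter, Finset.filter_filter]
    congr 1
    ext x
    simp [and_comm]
  have hdead : (deadE (var 9)).eval w mem ρ = if u ∈ A then 0 else 1 :=
    eval_deadE hF hB (e := var 9) h9 (hM.dead u) (by split_ifs <;> omega)
  have hmul : (deadE (var 9) * var 2).eval w mem ρ = if u ∈ A then 0 else n := by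
    rw [eval_mul hdead (f := var 2) hB.n (by split_ifs <;> omega)]
    split_ifs <;> simp
  rw [keyE, eval_add (eval_sum (eval_degE hF hM.input (e := var 9) h9) (fun e => ?_)
    (by rw [hsum]; omega)) hmul, hsum, key]
  · rw [hsum]
    split_ifs <;> omega
  · have hB' := hB.update (i := 10) (a := e) (by omega)
    exact eval_one_sub_deadE hF hM hB' (eval_nbrE hF hM.input hB' (u := u) (e := var 9)
      (f := var 10) (k := e) (by simp [eval, h9]) (by simp [eval]) e.2)

theorem cost_keyE_le (hF : Fits w m L) (hI : InputMem L mem) {u : Fin n} (h9 : ρ 9 = u) :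
    keyE.cost w mem ρ ≤ 40 + 40 * (L u).length := by
  have := cost_fold_le_mul (w := w) (mem := mem) (ρ := ρ) (a := 0) (i := 10)
    (N := (L u).length) (o := .add) (f := degE (var 9))
    (e := lit 1 - deadE (nbrE (var 9) (var 10))) (T := 20)
    (eval_degE hF hI (e := var 9) h9) (fun _ => le_rfl)
  rw [cost_degE] at this
  simp only [keyE, sum, cost_add, cost_mul, deadE, cost_load, cost_var] at this ⊢
  omega

/-- One step of the search for the smallest key. -/
theorem minBody_spec (hF : Fits w m L) (hL : IsAdjacencyList G L) (hM : MemOK G L A s.mem)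
    (hB : Base L m s.var) {u : Fin n} (h9 : s.var 9 = u) {b v : ℕ} (h6 : s.var 6 = b)
    (hb : b ≤ n) (h4 : s.var 4 = v) (hv : v ≤ u) :
    ((minBody.run w s).mem = s.mem ∧ Base L m (minBody.run w s).var ∧
      (minBody.run w s).var 0 = s.var 0 ∧
      (minBody.run w s).var 6 = min b (key G A u) ∧
      (minBody.run w s).var 4 = if key G A u < b then (u : ℕ) else v) ∧
    minBody.time w s ≤ 80 + 40 * (L u).length := by
  have h1 := hF.one_lt
  have hlt := hF.lt
  have hu := u.2
  set κ := key G A u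
  set ρ₁ := Function.update s.var 7 κ with hρ₁
  have hk : keyE.eval w s.mem s.var = κ := eval_keyE hF hL hM hB h9
  have e4 : (var 4 + (lit 1 - (lit 1 - (var 6 - var 7))) * (var 9 - var 4)).eval w s.mem ρ₁ =
      if κ < b then (u : ℕ) else v := by
    have hd : (var 6 - var 7).eval w s.mem ρ₁ = b - κ :=
      eval_sub (by simpa [eval, hρ₁] using h6) (by simp [eval, hρ₁]) (by omega)
    have hc := eval_sub (eval_lit h1) (eval_sub (eval_lit h1) hd h1) h1
    have hs : (var 9 - var 4).eval w s.mem ρ₁ = u - v :=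
      eval_sub (by simpa [eval, hρ₁] using h9) (by simpa [eval, hρ₁] using h4) (by omega)
    have hle : (1 - (1 - (b - κ))) * ((u : ℕ) - v) = if κ < b then u - v else 0 := by
      split_ifs with h
      · rw [show 1 - (1 - (b - κ)) = 1 by omega, one_mul]
      · rw [show 1 - (1 - (b - κ)) = 0 by omega, zero_mul]
    rw [eval_add (show eval w s.mem (var 4) ρ₁ = v by simpa [eval, hρ₁] using h4)
      (eval_mul hc hs (by rw [hle]; split_ifs <;> omega)) (by rw [hle]; split_ifs <;> omega), hle]
    split_ifs <;> omega
  set ρ₂ := Function.update ρ₁ 4 (if κ < b then (u : ℕ) else v) with hρ₂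
  have e6 : (var 6 - (var 6 - var 7)).eval w s.mem ρ₂ = min b κ := by
    have h6' : eval w s.mem (var 6) ρ₂ = b := by simpa [eval, hρ₁, hρ₂] using h6
    have h7' : eval w s.mem (var 7) ρ₂ = κ := by simp [eval, hρ₁, hρ₂]
    rw [eval_sub h6' (eval_sub h6' h7' (by omega)) (by omega)]
    omega
  have hrun : minBody.run w s = ⟨Function.update ρ₂ 6 (min b κ), s.mem⟩ := by
    simp only [minBody, Cmd.run, Store.set, hk]
    rw [← hρ₁, e4, ← hρ₂, e6]
  rw [hrun]
  refine ⟨⟨rfl, ((hB.update (by omega)).update (by omega)).update (by omega), ?_, ?_, ?_⟩, ?_⟩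
  · simp [hρ₁, hρ₂]
  · simp
  · simp [hρ₂]
  · have := cost_keyE_le (w := w) hF hM.input h9
    simp only [minBody, Cmd.time, cost_add, cost_sub, cost_mul, cost_var, cost_lit]
    omega

/-- If some remaining vertex has degree at most `d`, then so has the vertex that is found. The key
of a deleted vertex is at least `n`, which exceeds every degree. -/
theorem minCmd_spec (hF : Fits w m L) (hL : IsAdjacencyList G L) (hM : MemOK G L A s.mem)
    (hB : Base L m s.var) {d : ℕ} (hd : ∃ u ∈ A, (A.filter (G.Adj u)).card ≤ d) :
    ((minCmd.run w s).mem = s.mem ∧ Base L m (minCmd.run w s).var ∧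
      (minCmd.run w s).var 0 = s.var 0 ∧
      ∃ v ∈ A, (A.filter (G.Adj v)).card ≤ d ∧ (minCmd.run w s).var 4 = v) ∧
    minCmd.time w s ≤ 20 + 88 * n + 40 * offset L n := by
  have h1 := hF.one_lt
  have h0 : (lit 0).eval w s.mem s.var = 0 := eval_lit (by omega)
  set s₁ : Store := ⟨Function.update (Function.update s.var 4 0) 6 n, s.mem⟩ with hs₁
  have hB₁ : Base L m s₁.var := (hB.update (by omega)).update (by omega)
  have hrun : minCmd.run w s = (Cmd.loop 9 (var 2) minBody).run w s₁ := by
    have : eval w s.mem (var 2) (Function.update s.var 4 0) = n := by simp [eval, hB.n]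
    simp only [minCmd, Cmd.run, Store.set, h0, this, hs₁]
  have htime : minCmd.time w s = 3 + (4 + (Cmd.loop 9 (var 2) minBody).time w s₁) := by
    have : eval w s.mem (var 2) (Function.update s.var 4 0) = n := by simp [eval, hB.n]
    simp only [minCmd, Cmd.time, Cmd.run, Store.set, h0, this, hs₁, cost_lit, cost_var]
  obtain ⟨⟨hmem, hB', hv0, hle, hmin, hatt, -⟩, ht⟩ := Cmd.loop_spec (w := w) (i := 9) (N := n)
    (b := var 2) (c := minBody) (s := s₁)
    (fun k s' => s'.mem = s.mem ∧ Base L m s'.var ∧ s'.var 0 = s.var 0 ∧ s'.var 6 ≤ n ∧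
      (∀ u : Fin n, u < k → s'.var 6 ≤ key G A u) ∧
      (s'.var 6 < n → ∃ u : Fin n, s'.var 4 = u ∧ key G A u = s'.var 6) ∧ s'.var 4 ≤ k)
    (fun k => if h : k < n then 80 + 40 * (L ⟨k, h⟩).length else 0) hB₁.n
    ⟨rfl, hB₁, by simp [hs₁], by simp [hs₁], by simp, by simp [hs₁], by simp [hs₁]⟩ (by
      rintro k hk s' ⟨hmem, hB', hv0, hle, hmin, hatt, h4⟩
      obtain ⟨⟨r1, r2, r3, r4, r5⟩, r6⟩ := minBody_spec (s := s'.set 9 k) (A := A) (w := w) hF hL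
        (hmem ▸ hM : MemOK G L A s'.mem) (hB'.update (by omega)) (u := ⟨k, hk⟩)
        (by simp [Store.set]) (b := s'.var 6) (by simp [Store.set]) hle
        (v := s'.var 4) (by simp [Store.set]) h4
      refine ⟨⟨r1.trans hmem, r2, r3.trans (by simpa [Store.set] using hv0), ?_, ?_, ?_, ?_⟩, ?_⟩
      · rw [r4]
        omega
      · intro u hu
        rw [r4]
        rcases Nat.lt_succ_iff_lt_or_eq.1 hu with h | h
        · exact (min_le_left _ _).trans (hmin u h)
        · obtain rfl : u = ⟨k, hk⟩ := Fin.ext h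
          exact min_le_right _ _
      · intro h
        rw [r4] at h ⊢
        rw [r5]
        split_ifs with hlt
        · exact ⟨⟨k, hk⟩, rfl, by omega⟩
        · obtain ⟨u, hu, hu'⟩ := hatt (by omega)
          exact ⟨u, hu, by omega⟩
      · rw [r5]
        split_ifs
        · exact Nat.le_succ k
        · omega
      · rw [dif_pos hk]
        exact r6)
  rw [hrun, htime]
  refine ⟨⟨hmem, hB', hv0, ?_⟩, ?_⟩
  · obtain ⟨u, hu, hud⟩ := hd
    have hkey : ∀ x ∈ A, key G A x = (A.filter (G.Adj x)).card := fun x hx => by simp [key, hx]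
    have hun : key G A u < n := by
      rw [hkey u hu]
      have := Finset.card_lt_univ_of_notMem (s := A.filter (G.Adj u)) (x := u) (by simp)
      rwa [Fintype.card_fin] at this
    have hmu := hmin u u.2
    obtain ⟨v, hv, hv'⟩ := hatt (by omega)
    have hvA : v ∈ A := by
      by_contra hvA
      simp only [key, hvA, if_false] at hv'
      omega
    refine ⟨v, hvA, ?_, hv⟩
    rw [← hkey v hvA, hv']
    exact hmu.trans (by rw [hkey u hu]; exact hud)
  · rw [Finset.sum_range] at ht
    simp only [Fin.is_lt, dite_true, Fin.eta, Finset.sum_add_distrib, ← Finset.mul_sum,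
      ← offset_eq_sum, cost_var] at ht
    simp at ht
    omega

end

section

open Classical

variable {n w m : ℕ} {G : SimpleGraph (Fin n)} {L : Fin n → List (Fin n)} {A : Finset (Fin n)}
  {mem ρ : ℕ → ℕ} {s : Store}

/-- The second row of the table receives the list of the remaining neighbours of `v`. -/
theorem leftLoop_spec (hF : Fits w m L) (hL : IsAdjacencyList G L) (hM : MemOK G L A s.mem)
    (hB : Base L m s.var) {v : Fin n} (h4 : s.var 4 = v) (h5 : s.var 5 = 0) :
    let s' := (Cmd.loop 10 (degE (var 4)) leftBody).run w s
    let F := (L v).filter (· ∈ A)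
    (MemOK G L A s'.mem ∧ Base L m s'.var ∧ s'.var 0 = s.var 0 ∧ s'.var 4 = v ∧
      s'.var 5 = F.length ∧ ∀ i (h : i < F.length), s'.mem (base L + n + i) = F[i]) ∧
    (Cmd.loop 10 (degE (var 4)) leftBody).time w s ≤ 13 + 68 * n := by
  intro s' F
  have h1 := hF.one_lt
  have hlt := hF.lt
  have hn : n + n ≤ (n + 2) * n := by nlinarith
  have hlen := length_adjacencyList_le hL v
  obtain ⟨⟨hM', hB', hv0, hv4, hv5, hrow⟩, ht⟩ := Cmd.loop_spec (w := w) (i := 10)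
    (N := (L v).length) (b := degE (var 4)) (c := leftBody) (s := s)
    (fun k s' => MemOK G L A s'.mem ∧ Base L m s'.var ∧ s'.var 0 = s.var 0 ∧ s'.var 4 = v ∧
      s'.var 5 = (((L v).take k).filter (· ∈ A)).length ∧
      ∀ i (h : i < (((L v).take k).filter (· ∈ A)).length),
        s'.mem (base L + n + i) = (((L v).take k).filter (· ∈ A))[i])
    (fun _ => 60) (eval_degE hF hM.input (e := var 4) h4)
    ⟨hM, hB, rfl, h4, by simpa using h5, by simp⟩ (by
      rintro k hk s' ⟨hM', hB', hv0, hv4, hv5, hrow⟩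
      set F := ((L v).take k).filter (· ∈ A) with hFdef
      have hFk : F.length ≤ k := (List.length_filter_le _ _).trans (by simp)
      have hFn : F.length < n := by omega
      have htake : ((L v).take (k + 1)).filter (· ∈ A) =
          F ++ if (L v)[k] ∈ A then [(L v)[k]] else [] := by
        rw [List.take_add_one, List.getElem?_eq_getElem hk, List.filter_append, Option.toList_some,
          List.filter_singleton]
        by_cases hA : (L v)[k] ∈ A <;> simp [hA, hFdef]
      set ρ := Function.update s'.var 10 k with hρ
      have hBρ : Base L m ρ := hB'.update (by omega)
      have haddr : (var 3 + var 2 + var 5).eval w s'.mem ρ = base L + n + F.length := by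
        have hlt' := hF.mem_lt
        exact eval_add (eval_add (show eval w s'.mem (var 3) ρ = base L from hBρ.base)
          (show eval w s'.mem (var 2) ρ = n from hBρ.n) (by omega))
          (show eval w s'.mem (var 5) ρ = F.length by simpa [eval, hρ] using hv5) (by omega)
      have hx : ∀ {mem}, InputMem L mem →
          (nbrE (var 4) (var 10)).eval w mem ρ = (L v)[k] := fun hI =>
        eval_nbrE hF hI hBρ (u := v) (e := var 4) (f := var 10) (k := k)
          (by simpa [eval, hρ] using hv4) (by simp [eval, hρ]) hk
      have hM'' := hM'.update_row hFn ((L v)[k] : ℕ)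
      have h5' : (var 5 + (lit 1 - deadE (nbrE (var 4) (var 10)))).eval w
          (Function.update s'.mem (base L + n + F.length) (L v)[k]) ρ =
          F.length + if (L v)[k] ∈ A then 1 else 0 := by
        refine eval_add (by simpa [eval, hρ] using hv5)
          (eval_one_sub_deadE hF hM'' hBρ (hx hM''.input)) ?_
        split_ifs <;> omega
      have hrun : leftBody.run w (s'.set 10 k) =
          ⟨Function.update ρ 5 (F.length + if (L v)[k] ∈ A then 1 else 0),
            Function.update s'.mem (base L + n + F.length) (L v)[k]⟩ := by
        simp only [leftBody, Cmd.run, Store.set]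
        rw [← hρ, haddr, hx hM'.input, h5']
      rw [hrun]
      refine ⟨⟨hM'', hBρ.update (by omega), by simpa [hρ] using hv0, by simpa [hρ] using hv4,
        ?_, ?_⟩, ?_⟩
      · simp only [htake, Function.update_self, List.length_append]
        split_ifs <;> rfl
      · intro i hi
        simp only [htake] at hi ⊢
        by_cases h : i < F.length
        · rw [List.getElem_append_left h, Function.update_of_ne (by omega), hrow i h]
        · by_cases hA : (L v)[k] ∈ A
          · simp only [hA, if_true, List.length_append, List.length_singleton] at hi
            obtain rfl : i = F.length := by omega
            simp [hA]
          · simp [hA] at hi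
            exact absurd hi h
      · exact (show leftBody.time w (s'.set 10 k) = 48 from rfl).trans_le (by omega))
  refine ⟨⟨hM', hB', hv0, hv4, ?_, ?_⟩, ?_⟩
  · simpa [F] using hv5
  · simpa [F] using hrow
  · simp only [Finset.sum_const, Finset.card_range, smul_eq_mul, cost_degE] at ht
    omega

theorem toFinset_filter_adjacencyList (hL : IsAdjacencyList G L) (v : Fin n) :
    ((L v).filter (· ∈ A)).toFinset = A.filter (G.Adj v) := by
  ext x
  simp [(hL v).2, and_comm]

/-- The vertex removed in a round has `δ ≤ d` remaining neighbours, which leaves at most `d ^ m`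
tuples. -/
theorem roundCmd_spec (hF : Fits w m L) (hL : IsAdjacencyList G L) (hM : MemOK G L A s.mem)
    (hB : Base L m s.var) {d : ℕ} (hd : ∃ u ∈ A, (A.filter (G.Adj u)).card ≤ d) :
    (∃ v ∈ A, MemOK G L (A.erase v) (roundCmd.run w s).mem ∧ Base L m (roundCmd.run w s).var ∧
      (roundCmd.run w s).var 0 = (s.var 0 +
        ((coMatchingPairs G (m + 1) A).filter fun q => q.1 0 = v).card) % 2 ^ w) ∧
    roundCmd.time w s ≤ 100 + 200 * n + 40 * offset L n +
      (27 + d ^ m * (17 + 107 * n + 407 * offset L n)) * (m + 1) ^ 3 := by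
  have h1 := hF.one_lt
  have hlt := hF.lt
  have hn : n + n ≤ (n + 2) * n := by nlinarith
  obtain ⟨⟨hmem1, hB1, h01, v, hvA, hvd, hv1⟩, ht1⟩ := minCmd_spec hF hL hM hB hd
  set s1 := minCmd.run w s with hs1
  have hvn := v.2
  have ha : (var 3 + var 4).eval w s1.mem s1.var = base L + v :=
    eval_add (show eval w s1.mem (var 3) s1.var = base L from hB1.base) hv1
      (by have := hF.mem_lt; omega)
  have hl1 : (lit 1).eval w s1.mem s1.var = 1 := eval_lit h1
  set mem2 := Function.update s1.mem (base L + v) 1 with hmem2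
  have hM2 : MemOK G L (A.erase v) mem2 := by
    rw [hmem2, hmem1]
    exact hM.delete v
  have hl0 : (lit 0).eval w mem2 s1.var = 0 := eval_lit (by omega)
  set s2 : Store := ⟨Function.update s1.var 5 0, mem2⟩ with hs2
  have hB2 : Base L m s2.var := hB1.update (by omega)
  obtain ⟨⟨hM3, hB3, h03, h43, h53, hrow⟩, ht3⟩ := leftLoop_spec (s := s2) hF hL hM2 hB2 (v := v)
    (by simpa [hs2] using hv1) (by simp [hs2])
  set s3 := (Cmd.loop 10 (degE (var 4)) leftBody).run w s2 with hs3
  set F := (L v).filter (· ∈ A.erase v) with hFdef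
  have hFl : F.length ≤ n := (List.length_filter_le _ _).trans (length_adjacencyList_le hL v)
  have hnd : F.Nodup := (hL v).1.filter _
  have hFs : F.toFinset = (A.erase v).filter (G.Adj v) := toFinset_filter_adjacencyList hL v
  have hFd : F.length ≤ d := by
    rw [← List.toFinset_card_of_nodup hnd, hFs]
    exact (Finset.card_le_card (Finset.filter_subset_filter _ (Finset.erase_subset _ _))).trans hvd
  have hcore := eval_coreE hF hL hvA hM3 hB3 hnd hFs h53 hrow h43
  have hrun : roundCmd.run w s = s3.set 0 ((var 0 + coreE).eval w s3.mem s3.var) := by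
    simp only [roundCmd, Cmd.run, Store.set, ← hs1, ha, hl1]
    rfl
  have htime : roundCmd.time w s = minCmd.time w s + (7 + (3 +
      ((Cmd.loop 10 (degE (var 4)) leftBody).time w s2 + (5 + coreE.cost w s3.mem s3.var)))) := by
    have h2 : (Cmd.assign 5 (lit 0)).run w ((Cmd.write (var 3 + var 4) (lit 1)).run w s1) = s2 := by
      simp only [Cmd.run, Store.set, ha, hl1]
      rw [← hmem2, hl0]
    have t2 : ∀ s', (Cmd.write (var 3 + var 4) (lit 1)).time w s' = 7 := fun _ => rfl
    have t3 : ∀ s', (Cmd.assign 5 (lit 0)).time w s' = 3 := fun _ => rfl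
    have t5 : (Cmd.assign 0 (var 0 + coreE)).time w s3 = 5 + coreE.cost w s3.mem s3.var := by
      rw [Cmd.time, cost_add, cost_var]
      omega
    simp only [roundCmd, Cmd.time_seq, ← hs1]
    rw [h2, ← hs3, t2, t3, t5]
  rw [hrun, htime]
  refine ⟨⟨v, hvA, hM3, hB3.update (by omega), ?_⟩, ?_⟩
  · simp only [Store.set, Function.update_self]
    change (s3.var 0 + coreE.eval w s3.mem s3.var) % 2 ^ w = _
    rw [hcore, h03, Nat.add_mod_mod]
    simp [hs2, h01]
  · have hc := cost_coreE_le hF hM3.input hB3 h53 hFl (by omega)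
    have : F.length ^ m * (17 + 107 * n + 407 * offset L n) ≤
        d ^ m * (17 + 107 * n + 407 * offset L n) :=
      Nat.mul_le_mul_right _ (Nat.pow_le_pow_left hFd m)
    have := Nat.mul_le_mul_right ((m + 1) ^ 3) (Nat.add_le_add_left this 27)
    omega

/-! ### The adjacency matrix -/

/-- Writes the adjacency matrix into the memory, which is zero outside of the input: only the
entries that are equal to `1` have to be written. -/
def matrixCmd : Cmd :=
  .loop 9 (var 2) (.loop 10 (degE (var 9)) (.write (cellE (var 9) (nbrE (var 9) (var 10))) (lit 1)))

theorem matrixCmd_spec (hF : Fits w m L) (hL : IsAdjacencyList G L) (hI : InputMem L s.mem)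
    (h0 : ∀ x, base L ≤ x → s.mem x = 0) (hB : Base L m s.var) :
    (MemOK G L Finset.univ (matrixCmd.run w s).mem ∧ Base L m (matrixCmd.run w s).var ∧
      (matrixCmd.run w s).var 0 = s.var 0) ∧
    matrixCmd.time w s ≤ 4 + 21 * n + 50 * offset L n := by
  have h1 := hF.one_lt
  have hlt := hF.lt
  obtain ⟨⟨hI', hd', hc', hB', hv0⟩, ht⟩ := Cmd.loop_spec (w := w) (i := 9) (N := n)
    (b := var 2) (c := .loop 10 (degE (var 9)) (.write (cellE (var 9) (nbrE (var 9) (var 10)))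
      (lit 1))) (s := s)
    (fun k s' => InputMem L s'.mem ∧ (∀ u : Fin n, s'.mem (base L + u) = 0) ∧
      (∀ u x : Fin n, s'.mem (base L + (u + 2) * n + x) =
        if u < k ∧ G.Adj u x then 1 else 0) ∧ Base L m s'.var ∧ s'.var 0 = s.var 0)
    (fun k => if h : k < n then 13 + 50 * (L ⟨k, h⟩).length else 0) hB.n
    ⟨hI, fun u => h0 _ (by omega), fun u x => by rw [h0 _ (by omega)]; simp, hB, rfl⟩ (by
      rintro k hk s₁ ⟨hI₁, hd₁, hc₁, hB₁, hv₁⟩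
      set u : Fin n := ⟨k, hk⟩ with hu
      obtain ⟨⟨hI', hd', hc', hB', hv0, -⟩, ht⟩ := Cmd.loop_spec (w := w) (i := 10)
        (N := (L u).length) (b := degE (var 9))
        (c := .write (cellE (var 9) (nbrE (var 9) (var 10))) (lit 1)) (s := s₁.set 9 k)
        (fun l s' => InputMem L s'.mem ∧ (∀ u : Fin n, s'.mem (base L + u) = 0) ∧
          (∀ u' x : Fin n, s'.mem (base L + (u' + 2) * n + x) =
            if (u' < k ∧ G.Adj u' x) ∨ (u' = u ∧ x ∈ (L u).take l) then 1 else 0) ∧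
          Base L m s'.var ∧ s'.var 0 = s.var 0 ∧ s'.var 9 = k)
        (fun _ => 42) (eval_degE hF hI₁ (e := var 9) (u := u) (by simp [eval, Store.set, hu]))
        ⟨hI₁, hd₁, by simpa [Store.set] using hc₁, hB₁.update (by omega),
          by simpa [Store.set] using hv₁, by simp [Store.set]⟩ (by
          rintro l hl s₂ ⟨hI₂, hd₂, hc₂, hB₂, hv₂, h9₂⟩
          set ρ := Function.update s₂.var 10 l with hρ
          have hBρ : Base L m ρ := hB₂.update (by omega)
          have h9 : (var 9).eval w s₂.mem ρ = u := by simpa [eval, hρ, hu] using h9₂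
          have haddr : (cellE (var 9) (nbrE (var 9) (var 10))).eval w s₂.mem ρ =
              base L + (u + 2) * n + (L u)[l] :=
            eval_cellE hF hBρ h9 (eval_nbrE hF hI₂ hBρ h9 (by simp [eval, hρ]) hl)
          have hrun : (Cmd.write (cellE (var 9) (nbrE (var 9) (var 10))) (lit 1)).run w
              (s₂.set 10 l) =
              ⟨ρ, Function.update s₂.mem (base L + (u + 2) * n + (L u)[l]) 1⟩ := by
            simp only [Cmd.run, Store.set]
            rw [← hρ, haddr, eval_lit h1]
          have hrow : n ≤ ((u : ℕ) + 2) * n := Nat.le_mul_of_pos_left _ (by omega)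
          rw [hrun]
          refine ⟨⟨hI₂.update (by omega), fun u' => ?_, fun u' x => ?_, hBρ,
            by simpa [hρ] using hv₂, by simpa [hρ] using h9₂⟩,
            (show Cmd.time w _ (s₂.set 10 l) = 27 from rfl).trans_le (by omega)⟩
          · change Function.update _ _ _ _ = _
            rw [Function.update_of_ne (by have := u'.2; omega), hd₂]
          · change Function.update _ _ _ _ = _
            rw [List.take_add_one, List.getElem?_eq_getElem hl, Option.toList_some]
            by_cases hcell : u' = u ∧ x = (L u)[l]
            · rw [hcell.1, hcell.2, Function.update_self, if_pos (Or.inr ⟨rfl,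
                List.mem_append_right _ (List.mem_singleton_self _)⟩)]
            · rw [Function.update_of_ne, hc₂]
              · refine if_congr ?_ rfl rfl
                simp only [List.mem_append, List.mem_singleton]
                tauto
              · intro h
                exact hcell (cell_inj.1 (by omega)))
      refine ⟨⟨hI', hd', fun u' x => ?_, hB', hv0⟩, ?_⟩
      · rw [hc', List.take_length]
        refine if_congr ?_ rfl rfl
        rw [(hL u).2, Nat.lt_succ_iff_lt_or_eq, or_and_right]
        refine or_congr Iff.rfl ⟨?_, ?_⟩
        · rintro ⟨rfl, h⟩
          exact ⟨rfl, h⟩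
        · rintro ⟨h, h'⟩
          obtain rfl : u' = u := Fin.ext h
          exact ⟨rfl, h'⟩
      · simp only [Finset.sum_const, Finset.card_range, smul_eq_mul, cost_degE] at ht
        rw [dif_pos hk, ← hu]
        omega)
  refine ⟨⟨⟨hI', fun u => (hd' u).trans (by simp), fun u x => ?_⟩, hB', hv0⟩, ?_⟩
  · exact (hc' u x).trans (if_congr (by simp) rfl rfl)
  · rw [Finset.sum_range] at ht
    simp only [Fin.is_lt, dite_true, Fin.eta, Finset.sum_add_distrib, ← Finset.mul_sum,
      ← offset_eq_sum, cost_var] at ht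
    simp at ht
    exact ht.trans (by omega)

end

end WordRAM

/-! ### Degenerate graphs and their adjacency lists -/

section

open Classical

variable {n d : ℕ} {G : SimpleGraph (Fin n)} {L : Fin n → List (Fin n)} {A : Finset (Fin n)}

/-- The last vertex of `A` in a degeneracy order has only neighbours to its left in `A`. -/
theorem SimpleGraph.IsDegenerate.exists_card_filter_le (hG : G.IsDegenerate d)
    (hA : A.Nonempty) : ∃ u ∈ A, (A.filter (G.Adj u)).card ≤ d := by
  obtain ⟨o, ho⟩ := hG
  obtain ⟨u, hu, hmax⟩ := @Finset.exists_max_image _ _ o A id hA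
  refine ⟨u, hu, ?_⟩
  have := ho u
  rw [← Nat.cast_le (α := ℕ∞), ← Set.encard_coe_eq_coe_finsetCard]
  refine (Set.encard_le_encard ?_).trans this
  intro x hx
  simp only [Finset.coe_filter, Set.mem_ofPred_eq] at hx ⊢
  exact ⟨hx.2, @lt_of_le_of_ne _ o.toPartialOrder _ _ (hmax x hx.1) (G.ne_of_adj hx.2).symm⟩

/-- Every edge is counted at its right end and at its left end. -/
theorem SimpleGraph.IsDegenerate.sum_card_le (hG : G.IsDegenerate d) :
    ∑ u, (Finset.univ.filter (G.Adj u)).card ≤ 2 * d * n := by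
  obtain ⟨o, ho⟩ := hG
  have hl : ∀ u, (Finset.univ.filter fun x => G.Adj u x ∧ o.lt x u).card ≤ d := by
    intro u
    rw [← Nat.cast_le (α := ℕ∞), ← Set.encard_coe_eq_coe_finsetCard]
    simpa using ho u
  have hsplit : ∀ u, (Finset.univ.filter (G.Adj u)).card =
      (Finset.univ.filter fun x => G.Adj u x ∧ o.lt x u).card +
        (Finset.univ.filter fun x => G.Adj u x ∧ o.lt u x).card := by
    intro u
    rw [← Finset.card_union_of_disjoint]
    · congr 1
      ext x
      simp only [Finset.mem_filter, Finset.mem_univ, true_and, Finset.mem_union, ← and_or_left]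
      exact ⟨fun h => ⟨h, @lt_or_gt_of_ne _ o _ _ (G.ne_of_adj h).symm⟩, fun h => h.1⟩
    · rw [Finset.disjoint_filter]
      exact fun x _ h h' => @lt_asymm _ o.toPreorder _ _ h.2 h'.2
  have hswap : ∑ u, (Finset.univ.filter fun x => G.Adj u x ∧ o.lt u x).card =
      ∑ u, (Finset.univ.filter fun x => G.Adj u x ∧ o.lt x u).card := by
    simp only [Finset.card_filter]
    rw [Finset.sum_comm]
    simp only [G.adj_comm]
  simp only [hsplit, Finset.sum_add_distrib, hswap]
  have := Finset.sum_le_sum fun u (_ : u ∈ Finset.univ) => hl u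
  simp only [Finset.sum_const, Finset.card_univ, Fintype.card_fin, smul_eq_mul] at this
  nlinarith

theorem length_adjacencyList (hL : IsAdjacencyList G L) (u : Fin n) :
    (L u).length = (Finset.univ.filter (G.Adj u)).card := by
  rw [← List.toFinset_card_of_nodup (hL u).1]
  congr 1
  ext x
  simp [(hL u).2]

end

namespace WordRAM

open WordRAM.Expr

/-! ### The program -/

/-- Counts the co-matchings in a graph that has edges. In each round a vertex is removed. Among the
vertices of a co-matching let `v` be the one that is removed first, as a member of the first side;
then the co-matching has been counted once for each of the `m !` orders of its remaining pairs of
partners. Hence the sum is divided by `m !`, computed as the product of the numbers `i + 1`. -/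
def mainCmd : Cmd :=
  .seq matrixCmd (.seq (.loop 17 (var 2) roundCmd)
    (.assign 0 (var 0 / prod 15 (var 1) (var 15 + lit 1))))

/-- Counts the co-matchings. If the graph has no edges, then the answer is given at once: the bound
on the running time is independent of `n` for `d = 0`, so that not even a pass over all vertices is
possible. The last loop serves as a conditional. -/
def program : Cmd :=
  .seq (.assign 1 (load (lit 0) - lit 1)) (.seq (.assign 2 (load (lit 1))) (.seq
    (.assign 16 (load (lit 2 + var 2))) (.seq (.assign 3 (var 2 + lit 3 + var 16)) (.seq
    (.assign 0 ((lit 1 - var 16) * (lit 1 - var 1) * (var 2 * (var 2 - lit 1) / lit 2)))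
    (.loop 18 (lit 1 - (lit 1 - var 16)) mainCmd)))))

section input

variable {n t : ℕ} {L : Fin n → List (Fin n)}

theorem getD_encodeInput_offset {i : ℕ} (hi : i ≤ n) :
    (encodeInput t L).getD (2 + i) 0 = offset L i := by
  rw [encodeInput, List.getD_eq_getElem?_getD, List.getElem?_append_left (by simp; omega),
    add_comm 2 i]
  simp only [List.getElem?_cons_succ, List.getElem?_map]
  rw [List.getElem?_range (by omega)]
  rfl

theorem getD_encodeInput_nbr (u : Fin n) {e : ℕ} (he : e < (L u).length) :
    (encodeInput t L).getD (n + 3 + offset L u + e) 0 = (L u)[e] := by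
  rw [encodeInput, List.getD_eq_getElem?_getD, List.getElem?_append_right (by simp; omega)]
  simp only [List.length_cons, List.length_map, List.length_range, List.getElem?_map]
  rw [show n + 3 + offset L u + e - (n + 1 + 1 + 1) = offset L u + e by omega,
    getElem?_flatten_offset u he]
  rfl

theorem length_encodeInput : (encodeInput t L).length = base L := by
  rw [base, offset, List.take_of_length_le (by simp), ← List.length_flatten]
  simp only [encodeInput, List.cons_append, List.length_cons, List.length_append, List.length_map,
    List.length_range]
  omega

end input

section

open Classical

variable {n d w m : ℕ} {G : SimpleGraph (Fin n)} {L : Fin n → List (Fin n)} {s : Store}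

/-- The invariant of the rounds: the pairs of enumerated sides inside the remaining vertices,
together with `2 * (m + 1)` times the sum computed so far, account for all pairs. The sum is known
modulo `2 ^ w` only, but at the end it is smaller than `2 ^ w`. -/
theorem mainCmd_spec (hF : Fits w m L) (hL : IsAdjacencyList G L) (hG : G.IsDegenerate d)
    (hI : InputMem L s.mem) (h0 : ∀ x, base L ≤ x → s.mem x = 0) (hB : Base L m s.var)
    (hv : s.var 0 = 0) :
    (mainCmd.run w s).var 0 = (coMatching (m + 1)).count G ∧
    mainCmd.time w s ≤ 40 + 21 * n + 50 * offset L n + 11 * m +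
      n * (108 + 200 * n + 40 * offset L n +
      (27 + d ^ m * (17 + 107 * n + 407 * offset L n)) * (m + 1) ^ 3) := by
  have h1 := hF.one_lt
  have hlt := hF.lt
  obtain ⟨⟨hM1, hB1, hv1⟩, ht1⟩ := matrixCmd_spec hF hL hI h0 hB
  set s1 := matrixCmd.run w s with hs1
  obtain ⟨⟨A, hA, -, hB2, X, hX, hXA⟩, ht2⟩ := Cmd.loop_spec (w := w) (i := 17) (N := n)
    (b := var 2) (c := roundCmd) (s := s1)
    (fun k s' => ∃ A : Finset (Fin n), A.card + k = n ∧ MemOK G L A s'.mem ∧ Base L m s'.var ∧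
      ∃ X, s'.var 0 = X % 2 ^ w ∧ (coMatchingPairs G (m + 1) Finset.univ).card =
        2 * (m + 1) * X + (coMatchingPairs G (m + 1) A).card)
    (fun _ => 100 + 200 * n + 40 * offset L n +
      (27 + d ^ m * (17 + 107 * n + 407 * offset L n)) * (m + 1) ^ 3) hB1.n
    ⟨Finset.univ, by simp, hM1, hB1, 0, by rw [hv1, hv, Nat.zero_mod], by simp⟩ (by
      rintro k hk s' ⟨A, hA, hM, hB', X, hX, hXA⟩
      have hne : A.Nonempty := Finset.card_pos.1 (by omega)
      obtain ⟨⟨v, hvA, hM', hB'', hv0⟩, ht⟩ := roundCmd_spec (s := s'.set 17 k) hF hL hM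
        (hB'.update (by omega)) (hG.exists_card_filter_le hne)
      refine ⟨⟨A.erase v, ?_, hM', hB'',
        X + ((coMatchingPairs G (m + 1) A).filter fun q => q.1 0 = v).card, ?_, ?_⟩, ht⟩
      · rw [Finset.card_erase_of_mem hvA]
        omega
      · rw [hv0, show (s'.set 17 k).var 0 = X % 2 ^ w by simpa [Store.set] using hX,
          Nat.mod_add_mod]
      · rw [hXA, card_coMatchingPairs_erase G m A v]
        ring)
  obtain rfl : A = ∅ := Finset.card_eq_zero.1 (by omega)
  set s2 := (Cmd.loop 17 (var 2) roundCmd).run w s1 with hs2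
  -- the `2 * (m + 1)` places of a vertex and the `m !` orders account for all enumerations
  have hXc : X = (coMatching (m + 1)).count G * m.factorial := by
    rw [coMatchingPairs_empty G (by omega), Finset.card_empty, add_zero,
      card_coMatchingPairs_univ G (by omega), Nat.factorial_succ] at hXA
    have : (m + 1) * X = (m + 1) * ((coMatching (m + 1)).count G * m.factorial) := by linarith
    exact Nat.eq_of_mul_eq_mul_left (by omega) this
  have hXw : X < 2 ^ w := by
    have := card_coMatchingPairs_le G (m + 1) Finset.univ
    rw [Fintype.card_fin] at this
    refine lt_of_le_of_lt ?_ (this.trans_lt hF.pow_lt)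
    rw [hXA]
    nlinarith [Nat.zero_le (m * X)]
  have hv2 : s2.var 0 = X := by rw [hX, Nat.mod_eq_of_lt hXw]
  have hstep : ∀ k : Fin m, (var 15 + lit 1).eval w s2.mem (Function.update s2.var 15 k) =
      (k : ℕ) + 1 :=
    fun k => eval_add (by simp [eval]) (eval_lit h1) (by have := hF.m_lt; omega)
  have hfact := eval_prod_mod (mem := s2.mem) (f := var 1) (F := fun k : Fin m => (k : ℕ) + 1) hB2.m
    (fun k => by rw [hstep k])
  rw [← Finset.prod_range fun k => k + 1, Finset.prod_range_add_one_eq_factorial] at hfact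
  have hrun : mainCmd.run w s =
      s2.set 0 ((var 0 / prod 15 (var 1) (var 15 + lit 1)).eval w s2.mem s2.var) := rfl
  have htime : mainCmd.time w s = matrixCmd.time w s +
      ((Cmd.loop 17 (var 2) roundCmd).time w s1 +
        (5 + (prod 15 (var 1) (var 15 + lit 1)).cost w s2.mem s2.var)) := by
    have t3 : (Cmd.assign 0 (var 0 / prod 15 (var 1) (var 15 + lit 1))).time w s2 =
        5 + (prod 15 (var 1) (var 15 + lit 1)).cost w s2.mem s2.var := by
      rw [Cmd.time, cost_div, cost_var]
      omega
    simp only [mainCmd, Cmd.time_seq, ← hs1]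
    rw [← hs2, t3]
  refine ⟨?_, ?_⟩
  · rw [hrun]
    simp only [Store.set, Function.update_self]
    rw [eval_div (e := var 0) hv2 hfact hXw]
    -- if there is no co-matching, then `m !` may exceed the word size, but the quotient is `0`
    -- even if the residue of `m !` is `0`, since division by `0` gives `0`
    rcases Nat.eq_zero_or_pos ((coMatching (m + 1)).count G) with hc | hc
    · rw [hXc, hc, zero_mul, Nat.zero_div]
    · have hle : m.factorial ≤ X := by
        rw [hXc]
        exact Nat.le_mul_of_pos_left _ hc
      rw [Nat.mod_eq_of_lt (by omega), hXc, Nat.mul_div_cancel _ (Nat.factorial_pos m)]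
  · have hc := cost_fold_le_mul (w := w) (mem := s2.mem) (ρ := s2.var) (a := 1) (i := 15) (N := m)
      (o := .mul) (f := var 1) (e := var 15 + lit 1) (T := 4) hB2.m (fun _ => le_rfl)
    simp only [Finset.sum_const, Finset.card_range, smul_eq_mul, cost_var] at ht2 hc
    rw [htime]
    simp only [prod]
    have : n * (100 + 200 * n + 40 * offset L n +
      (27 + d ^ m * (17 + 107 * n + 407 * offset L n)) * (m + 1) ^ 3 + 8) =
      n * (108 + 200 * n + 40 * offset L n +
      (27 + d ^ m * (17 + 107 * n + 407 * offset L n)) * (m + 1) ^ 3) := by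
      congr 1
      omega
    omega

/-- Without edges there are co-matchings with two vertices only, one for every pair of vertices. -/
theorem count_coMatching_of_forall_not_adj (hG : ∀ u v, ¬ G.Adj u v) :
    (coMatching (m + 1)).count G = (1 - m) * (n * (n - 1) / 2) := by
  have h := card_coMatchingPairs_univ G (t := m + 1) (by omega)
  rcases Nat.eq_zero_or_pos m with rfl | hm
  · have hcard : (coMatchingPairs G 1 Finset.univ).card = n * (n - 1) := by
      have hoff : (Finset.univ : Finset (Fin n)).offDiag.card = n * (n - 1) := by
        rw [Finset.offDiag_card]
        simp [Nat.mul_sub]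
      rw [← hoff]
      refine Finset.card_nbij' (fun q => (q.1 0, q.2 0)) (fun p => (fun _ => p.1, fun _ => p.2))
        ?_ ?_ ?_ ?_
      · intro q hq
        have := (mem_coMatchingPairs.1 hq).2.2 0
        simpa using this
      · intro p hp
        have hp' : p.1 ≠ p.2 := by simpa using hp
        refine mem_coMatchingPairs.2 ⟨by simp, fun i j => ?_, fun _ => hp'⟩
        simp [hG, Subsingleton.elim i j]
      · intro q _
        ext i <;> simp [Subsingleton.elim i 0]
      · intro p _
        rfl
    simp only [zero_add, hcard, Nat.factorial_one, mul_one, Nat.sub_zero, one_mul] at h ⊢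
    omega
  · have hempty : coMatchingPairs G (m + 1) Finset.univ = ∅ := by
      ext q
      simp only [mem_coMatchingPairs, Finset.notMem_empty, iff_false]
      rintro ⟨-, hadj, -⟩
      exact hG _ _ ((hadj 0 (Fin.last m)).2 (Fin.ne_of_lt (by simpa [Fin.lt_def] using hm)))
    rw [hempty, Finset.card_empty] at h
    have hf := Nat.factorial_pos (m + 1)
    have : (coMatching (m + 1)).count G = 0 := by
      rcases Nat.mul_eq_zero.1 h.symm with h | h
      · exact h
      · omega
    rw [this, Nat.sub_eq_zero_of_le hm, zero_mul]

/-- The number `offset L n` is the total length of the adjacency lists, so it is `0` if and only if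
there are no edges. -/
theorem program_spec (hF : Fits w m L) (hL : IsAdjacencyList G L) (hG : G.IsDegenerate d)
    (hmw : m + 1 < 2 ^ w) {mem : ℕ → ℕ} (hm0 : mem 0 = m + 1) (hm1 : mem 1 = n)
    (hI : InputMem L mem) (h0 : ∀ x, base L ≤ x → mem x = 0) :
    (program.run w ⟨fun _ => 0, mem⟩).var 0 = (coMatching (m + 1)).count G ∧
    program.time w ⟨fun _ => 0, mem⟩ ≤ 60 + if offset L n = 0 then 0 else
      50 + 21 * n + 50 * offset L n + 11 * m +
      n * (108 + 200 * n + 40 * offset L n +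
      (27 + d ^ m * (17 + 107 * n + 407 * offset L n)) * (m + 1) ^ 3) := by
  have h1 := hF.one_lt
  have hlt := hF.lt
  set o := offset L n with ho
  have e1 : (load (lit 0) - lit 1).eval w mem (fun _ => 0) = m :=
    eval_sub (eval_load (eval_lit (by omega)) hm0 hmw) (eval_lit h1) hmw
  set ρ1 := Function.update (fun _ => 0 : ℕ → ℕ) 1 m with hρ1
  have e2 : (load (lit 1)).eval w mem ρ1 = n := eval_load (eval_lit h1) hm1 (by omega)
  set ρ2 := Function.update ρ1 2 n with hρ2
  have e3 : (load (lit 2 + var 2)).eval w mem ρ2 = o :=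
    eval_load (eval_add (eval_lit (by omega)) (f := var 2) (b := n) (by simp [eval, hρ2])
      (by omega)) (hI.offset n le_rfl) (by omega)
  set ρ3 := Function.update ρ2 16 o with hρ3
  have e4 : (var 2 + lit 3 + var 16).eval w mem ρ3 = base L :=
    eval_add (eval_add (e := var 2) (a := n) (by simp [eval, hρ2, hρ3]) (eval_lit (by omega))
      (by omega)) (f := var 16) (b := o) (by simp [eval, hρ3]) (by omega)
  set ρ4 := Function.update ρ3 3 (base L) with hρ4
  have hle : n * (n - 1) ≤ (n + 2) * n := by
    rw [mul_comm (n + 2)]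
    exact Nat.mul_le_mul_left _ (by omega)
  have hind : (1 - o) * (1 - m) ≤ 1 := by
    have h : 1 - o ≤ 1 := Nat.sub_le _ _
    have h' : 1 - m ≤ 1 := Nat.sub_le _ _
    nlinarith
  have e5 : ((lit 1 - var 16) * (lit 1 - var 1) * (var 2 * (var 2 - lit 1) / lit 2)).eval w mem
      ρ4 = (1 - o) * (1 - m) * (n * (n - 1) / 2) := by
    have hn : (var 2).eval w mem ρ4 = n := by simp [eval, hρ2, hρ3, hρ4]
    have hbound : (1 - o) * (1 - m) * (n * (n - 1) / 2) ≤ n * (n - 1) / 2 :=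
      (Nat.mul_le_mul_right _ hind).trans (by rw [one_mul])
    exact eval_mul (eval_mul
      (eval_sub (eval_lit h1) (f := var 16) (by simp [eval, hρ3, hρ4]) h1)
      (eval_sub (eval_lit h1) (f := var 1) (by simp [eval, hρ1, hρ2, hρ3, hρ4]) h1) (by omega))
      (eval_div (eval_mul hn (eval_sub hn (eval_lit h1) (by omega)) (by omega))
      (eval_lit (by omega)) (by omega)) (by omega)
  set ρ5 := Function.update ρ4 0 ((1 - o) * (1 - m) * (n * (n - 1) / 2)) with hρ5
  have e6 : (lit 1 - (lit 1 - var 16)).eval w mem ρ5 = 1 - (1 - o) :=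
    eval_sub (eval_lit h1) (eval_sub (eval_lit h1) (f := var 16)
      (by simp [eval, hρ3, hρ4, hρ5]) h1) h1
  have hpre : (Cmd.assign 0 ((lit 1 - var 16) * (lit 1 - var 1) *
      (var 2 * (var 2 - lit 1) / lit 2))).run w ((Cmd.assign 3 (var 2 + lit 3 + var 16)).run w
      ((Cmd.assign 16 (load (lit 2 + var 2))).run w ((Cmd.assign 2 (load (lit 1))).run w
      ((Cmd.assign 1 (load (lit 0) - lit 1)).run w ⟨fun _ => 0, mem⟩)))) = ⟨ρ5, mem⟩ := by
    simp only [Cmd.run, Store.set]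
    rw [e1, ← hρ1, e2, ← hρ2, e3, ← hρ3, e4, ← hρ4, e5]
  have hrun : program.run w ⟨fun _ => 0, mem⟩ =
      (Cmd.loop 18 (lit 1 - (lit 1 - var 16)) mainCmd).run w ⟨ρ5, mem⟩ := by
    simp only [program, Cmd.run_seq]
    rw [hpre]
  have htime : program.time w ⟨fun _ => 0, mem⟩ = 6 + (4 + (7 + (9 + (21 +
      (Cmd.loop 18 (lit 1 - (lit 1 - var 16)) mainCmd).time w ⟨ρ5, mem⟩)))) := by
    simp only [program, Cmd.time_seq]
    rw [hpre]
    rfl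
  have hB : Base L m ρ5 := ⟨by simp [hρ1, hρ2, hρ3, hρ4, hρ5], by simp [hρ2, hρ3, hρ4, hρ5],
    by simp [hρ4, hρ5]⟩
  rw [hrun, htime, Cmd.run, Cmd.time]
  simp only [e6]
  rcases Nat.eq_zero_or_pos o with hz | hpos
  · rw [hz]
    refine ⟨?_, ?_⟩
    · change ρ5 0 = _
      rw [hρ5, Function.update_self, count_coMatching_of_forall_not_adj, hz, Nat.sub_zero, one_mul]
      intro u v huv
      rw [ho, offset_eq_sum] at hz
      have := (Finset.sum_eq_zero_iff.1 hz) u (Finset.mem_univ _)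
      rw [List.length_eq_zero_iff] at this
      have hv := ((hL u).2 v).2 huv
      rw [this] at hv
      exact List.not_mem_nil hv
    · simp only [Nat.sub_zero, Nat.sub_self, Finset.range_zero, Finset.sum_empty, if_true,
        cost_sub, cost_lit, cost_var]
      omega
  · have hone : 1 - (1 - o) = 1 := by omega
    have hv5 : ρ5 0 = 0 := by
      rw [hρ5, Function.update_self, show 1 - o = 0 by omega, zero_mul, zero_mul]
    obtain ⟨hv, ht⟩ := mainCmd_spec (s := (⟨ρ5, mem⟩ : Store).set 18 0) hF hL hG hI h0
      (hB.update (by omega)) (by simpa [Store.set] using hv5)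
    rw [hone]
    refine ⟨hv, ?_⟩
    rw [if_neg (by omega)]
    rw [← ho] at ht
    simp only [Finset.range_one, Finset.sum_singleton, cost_sub, cost_lit, cost_var, Nat.rec_zero]
    omega

end

/-! ### The bounds -/

/-- The constant `8`: since `n + 2 ≤ 2 ^ (2 * log (n + 2))`, a word can hold `(n + 2) ^ (4 * t)`,
which exceeds both the number of memory cells in use and the bound `n ^ (2 * t)` for the number of
pairs of enumerated sides. -/
theorem fits_of_le {n m w : ℕ} {G : SimpleGraph (Fin n)} {L : Fin n → List (Fin n)}
    (hL : IsAdjacencyList G L) (hw : 8 * ((m + 1) * Nat.log 2 (n + 2)) ≤ w) :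
    Fits w m L ∧ m + 1 < 2 ^ w ∧ 1 ≤ w := by
  have hℓ : 1 ≤ Nat.log 2 (n + 2) := Nat.log_pos (by omega) (by omega)
  set ℓ := Nat.log 2 (n + 2) with hℓdef
  have hmℓ : m + 1 ≤ (m + 1) * ℓ := Nat.le_mul_of_pos_right _ hℓ
  have hmw : m + 1 < 2 ^ w := lt_of_le_of_lt (by omega) (Nat.lt_two_pow_self (n := w))
  have hn : n + 2 ≤ 2 ^ (2 * ℓ) :=
    (Nat.lt_pow_succ_log_self (by omega) (n + 2)).le.trans
      (Nat.pow_le_pow_right (by omega) (by omega))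
  have hpow : (n + 2) ^ (4 * (m + 1)) ≤ 2 ^ w :=
    calc (n + 2) ^ (4 * (m + 1)) ≤ (2 ^ (2 * ℓ)) ^ (4 * (m + 1)) := Nat.pow_le_pow_left hn _
      _ = 2 ^ (8 * ((m + 1) * ℓ)) := by rw [← pow_mul]; congr 1; ring
      _ ≤ 2 ^ w := Nat.pow_le_pow_right (by omega) hw
  have hoff : offset L n ≤ n * n := by
    rw [offset_eq_sum]
    exact (Finset.sum_le_sum fun u _ => length_adjacencyList_le hL u).trans (by simp)
  refine ⟨⟨?_, by omega, ?_⟩, hmw, by omega⟩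
  · have h4 : (n + 2) ^ 4 ≤ (n + 2) ^ (4 * (m + 1)) := Nat.pow_le_pow_right (by omega) (by omega)
    have h2 : 4 * (n + 2) ^ 2 ≤ (n + 2) ^ 4 := by
      rw [show (n + 2) ^ 4 = (n + 2) ^ 2 * (n + 2) ^ 2 by ring]
      exact Nat.mul_le_mul_right _ (by nlinarith)
    unfold base
    nlinarith
  · calc n ^ (2 * (m + 1)) < (n + 2) ^ (2 * (m + 1)) := Nat.pow_lt_pow_left (by omega) (by omega)
      _ ≤ (n + 2) ^ (4 * (m + 1)) := Nat.pow_le_pow_right (by omega) (by omega)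
      _ ≤ 2 ^ w := hpow

/-- If there are edges, then the running time is of the order `n² dᵗ t³`. -/
theorem time_bound {n d m o : ℕ} (ho : o ≤ 2 * d * n) (hpos : o ≠ 0) :
    50 + 21 * n + 50 * o + 11 * m + n * (108 + 200 * n + 40 * o +
      (27 + d ^ m * (17 + 107 * n + 407 * o)) * (m + 1) ^ 3) ≤
    2000 * (n ^ 2 * (8 * d) ^ (m + 1) * d * (m + 1) ^ 3) := by
  have hd : 1 ≤ d := by
    rcases Nat.eq_zero_or_pos d with rfl | h
    · simp at ho
      omega
    · exact h
  have hn : 1 ≤ n := by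
    rcases Nat.eq_zero_or_pos n with rfl | h
    · simp at ho
      omega
    · exact h
  set Q := d ^ m with hQ
  set R := (m + 1) ^ 3 with hR
  have hQ1 : 1 ≤ Q := Nat.one_le_pow _ _ hd
  have hRm : m + 1 ≤ R := Nat.le_self_pow (by omega) _
  set D := d * n with hD
  have hDn : n ≤ D := Nat.le_mul_of_pos_left _ hd
  have hoD : o ≤ 2 * D := by rw [hD, ← mul_assoc]; exact ho
  -- everything is at most a constant times `n * D * (Q * R)`
  set S := Q * R with hS
  have hRS : R ≤ S := Nat.le_mul_of_pos_left _ hQ1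
  have hDS : D * S ≤ n * (D * S) := Nat.le_mul_of_pos_left _ hn
  have hDDS : D ≤ D * S := Nat.le_mul_of_pos_right _ (by omega)
  have hSDS : S ≤ D * S := Nat.le_mul_of_pos_left _ (by omega)
  have h1 : (27 + Q * (17 + 107 * n + 407 * o)) * R ≤ 965 * (D * S) := by
    have : 27 + Q * (17 + 107 * n + 407 * o) ≤ Q * (965 * D) :=
      calc 27 + Q * (17 + 107 * n + 407 * o)
          ≤ Q * 27 + Q * (17 + 107 * n + 407 * o) := by omega
        _ = Q * (44 + 107 * n + 407 * o) := by ring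
        _ ≤ Q * (965 * D) := Nat.mul_le_mul_left _ (by omega)
    calc _ ≤ Q * (965 * D) * R := Nat.mul_le_mul_right _ this
      _ = _ := by rw [hS]; ring
  have h2 : n * (108 + 200 * n + 40 * o + (27 + Q * (17 + 107 * n + 407 * o)) * R) ≤
      n * (1353 * (D * S)) := Nat.mul_le_mul_left _ (by omega)
  have h3 : n * (D * S) ≤ n ^ 2 * (8 * d) ^ (m + 1) * d * R := by
    have : Q ≤ (8 * d) ^ (m + 1) :=
      (Nat.pow_le_pow_left (by omega) m).trans (Nat.pow_le_pow_right (by omega) (by omega))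
    calc n * (D * S) = n ^ 2 * Q * d * R := by rw [hD, hS]; ring
      _ ≤ _ := Nat.mul_le_mul_right _ (Nat.mul_le_mul_right _ (Nat.mul_le_mul_left _ this))
  have h4 : n * (1353 * (D * S)) = 1353 * (n * (D * S)) := by ring
  omega

/-- The summand `t ^ 2 * (2 * t)!` of the bound pays for the constant time in the case of a graph
without edges, and `n ^ 2 * (8 * d) ^ t * d * t ^ 3` for everything else. -/
theorem program_computesWithin {n d t w : ℕ} {G : SimpleGraph (Fin n)} {L : Fin n → List (Fin n)}
    (ht : 1 ≤ t) (hG : G.IsDegenerate d) (hL : IsAdjacencyList G L)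
    (hw : 8 * (d + t * Nat.log 2 (n + 2)) ≤ w) :
    ComputesWithin (program.compile 0 0) w (encodeInput t L)
      (2000 * (t ^ 2 * Nat.factorial (2 * t) + d * 2 ^ d * n + n ^ 2 * (8 * d) ^ t * d * t ^ 3))
      ((coMatching t).count G) := by
  obtain ⟨m, rfl⟩ : ∃ m, t = m + 1 := ⟨t - 1, by omega⟩
  obtain ⟨hF, hmw, hw1⟩ := fits_of_le hL (m := m) (w := w) (by omega)
  have hlt := hF.lt
  set mem : ℕ → ℕ := fun a => (encodeInput (m + 1) L).getD a 0 % 2 ^ w with hmem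
  have hI : InputMem L mem := by
    refine ⟨fun i hi => ?_, fun u e he => ?_⟩
    · have := offset_mono (L := L) hi
      simp only [hmem]
      rw [getD_encodeInput_offset hi, Nat.mod_eq_of_lt (by omega)]
    · have := ((L u)[e]).2
      simp only [hmem]
      rw [getD_encodeInput_nbr u he, Nat.mod_eq_of_lt (by omega)]
  have h0 : ∀ x, base L ≤ x → mem x = 0 := by
    intro x hx
    simp only [hmem]
    rw [List.getD_eq_default _ _ (by rw [length_encodeInput]; exact hx), Nat.zero_mod]
  have hm0 : mem 0 = m + 1 := by
    simp only [hmem]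
    exact Nat.mod_eq_of_lt hmw
  have hm1 : mem 1 = n := by
    simp only [hmem]
    exact Nat.mod_eq_of_lt (show n < 2 ^ w by omega)
  obtain ⟨hv, htime⟩ := program_spec hF hL hG hmw hm0 hm1 hI h0
  obtain ⟨k, hk, hhalt, hout⟩ := program.computesWithin hw1 (encodeInput (m + 1) L)
  refine ⟨k, hk.trans (htime.trans ?_), hhalt, hout.trans hv⟩
  have hfact : 1 ≤ (m + 1) ^ 2 * Nat.factorial (2 * (m + 1)) :=
    Nat.mul_pos (by positivity) (Nat.factorial_pos _)
  have hoff : offset L n ≤ 2 * d * n := by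
    classical
    rw [offset_eq_sum]
    simp only [length_adjacencyList hL]
    convert hG.sum_card_le
  split_ifs with hz
  · omega
  · have := time_bound (m := m) hoff hz
    omega

end WordRAM

theorem mainTheorem8 :
    (∃ (P : WordRAM.Program) (c C : ℕ),
      ∀ (n d t w : ℕ) (G : SimpleGraph (Fin n)) (L : Fin n → List (Fin n)),
        1 ≤ t → G.IsDegenerate d → IsAdjacencyList G L →
        c * (d + t * Nat.log 2 (n + 2)) ≤ w →
        WordRAM.ComputesWithin P w (encodeInput t L)
          (C * (t ^ 2 * Nat.factorial (2 * t) + d * 2 ^ d * n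
            + n ^ 2 * (8 * d) ^ t * d * t ^ 3))
          ((coMatching t).count G)) ∧
    (∀ t : ℕ, 2 ≤ t →
      (coMatching t).leftCoveringNumber (coMatchingX t) (coMatchingY t) = 2) ∧
    (∀ t : ℕ, 1 ≤ t →
      (coMatching t).halfOrderingAsymmetry (coMatchingX t) (coMatchingY t) = 1) :=
  ⟨⟨WordRAM.program.compile 0 0, 8, 2000, fun _ _ _ _ _ _ ht hG hL hw =>
    WordRAM.program_computesWithin ht hG hL hw⟩,
    fun _ ht => leftCoveringNumber_coMatching ht, fun t _ => halfOrderingAsymmetry_coMatching t⟩
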